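/- **Setting.** There are $n>1$ locations $\mathcal L=\{1,\dots,n\}$ and $m>0$ units of drivers. A trip $(i,j)\in\mathcal L^2$ has duration $d_{i,j}>0$, cost $c_{i,j}\ge 0$ and a rider demand function $q_{i,j}:\mathbb R_{\ge0}\to\mathbb R_{\ge 0}$ that is continuously differentiable with $q_{i,j}'<0$ and $\int_0^\infty q_{i,j}(r)\,dr<\infty$; $v_{i,j}$ denotes the inverse function of $q_{i,j}$. The platform chooses phantom demand functions $\tilde q_{i,j}:\mathbb R_{\ge0}\to\mathbb R_{\ge 0}$ that are continuously differentiable, (weakly) decreasing, with $d_{i,j}\tilde q_{i,j}(0)>m$ and $\lim_{r\to\infty}\tilde q_{i,j}(r)=0$. Put $e_{i,j}=\sup_{r\ge0} r\,\tilde q_{i,j}(r)\in[0,\infty]$. Rider and driver flows $(x,y)$ are feasible if $0\le x_{i,j}\le y_{i,j}$, $\sum_{i,j}d_{i,j}y_{i,j}\le m$ and $\sum_j y_{i,j}=\sum_j y_{j,i}$ for all $i$. Their welfare is $\sum_{i,j}\bigl(\int_0^{x_{i,j}}v_{i,j}(s)\,ds-c_{i,j}y_{i,j}\bigr)$, read as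 $-\infty$ if $x_{i,j}>q_{i,j}(0)$ for some $(i,j)$. The welfare suboptimality of an outcome is the supremum of the welfare over all feasible flows minus the welfare of the outcome. Given adjustments $\phi\in\mathbb R^{n}$ with $\phi_n=0$ (identified with $\phi\in\mathbb R^{n-1}$), multipliers $\pi\in\mathbb R^n$ *clear the market*, and $(x,y,p,\phi,\pi)$ is an *origin-based market-clearing outcome*, if $p_{i,j}=c_{i,j}+d_{i,j}\pi_i+\phi_i-\phi_j\ge 0$, $x_{i,j}=q_{i,j}(p_{i,j})$, $y_{i,j}=x_{i,j}+\tilde q_{i,j}(p_{i,j})$, the flows $(x,y)$ are feasible, and $\sum_{i,j}d_{i,j}y_{i,j}=m$. Let $\Pi(\phi)$ denote the market-clearing multipliers, $\mathrm D\Pi$ the Jacobian of $\Pi$, and $f(\phi)=\sum_i\bigl(\Pi_i(\phi)-\frac1n\sum_j\Pi_j(\phi)\bigr)^2$. **INP mechanism** with parameters $\tau>0$, $\beta,\sigma\in(0,1)$. The economy $(m,d,c,q)$ and $\tilde q$ are the same at all times. Set $\phi^{(0)}=0$ and $\pi^{(t)}=\Pi(\phi^{(t)})$. At each time $t\ge1$: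 if $t=1$ or $f(\phi^{(t-1)})<f(\phi^{(t')})+\sigma\nabla f(\phi^{(t')})^{\mathsf T}\alpha^{(t-1)}\delta^{(t-1)}$, where $t'$ is the timestep prior to the most recent update of the direction, set $$\delta^{(t)}=\Bigl(\begin{bmatrix}-\mathrm D\Pi(\phi^{(t-1)})&\mathbf 1_n\end{bmatrix}^{-1}\pi^{(t-1)}\Bigr)_{1:n-1},\qquad \alpha^{(t)}=\min\bigl\{1,\tau/\|\mathrm D\Pi(\phi^{(t-1)})\delta^{(t)}\|_\infty\bigr\},$$ with $\tau/0=\infty$, and $\phi^{(t)}=\phi^{(t-1)}+\alpha^{(t)}\delta^{(t)}$. Otherwise backtrack: $\delta^{(t)}=\delta^{(t-1)}$, $\alpha^{(t)}=\beta\alpha^{(t-1)}$, $\phi^{(t)}=\phi^{(t')}+\alpha^{(t)}\delta^{(t)}$. **Theorem.** 1. The mechanism is well defined: for every $\phi\in\mathbb R^{n-1}$ there is exactly one market-clearing $\pi=\Pi(\phi)$, the map $\Pi$ is continuously differentiable, and $\begin{bmatrix}-\mathrm D\Pi(\phi)&\mathbf 1_n\end{bmatrix}$ is invertible for every $\phi$.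 It is an iterative pricing mechanism: for fixed $(m,d,c)$, $\tilde q$, $\tau,\beta,\sigma$ there is a rule, not depending on $q$, that gives $\phi^{(t)}$ as a function of the observed market-clearing outcomes $(x^{(s)},y^{(s)},p^{(s)},\phi^{(s)},\pi^{(s)})$ and price sensitivities $q_{i,j}'(p^{(s)}_{i,j})$ of the timesteps $s<t$. 2. For every economy, the mechanism converges to an origin-based market-clearing outcome $(x^\star,y^\star,p^\star,\phi^\star,\pi^\star)$ all of whose multipliers are equal: there is $\omega^\star\in\mathbb R$ with $\pi^\star_i=\omega^\star=\lim_{t\to\infty}\pi_i^{(t)}$ for all $i\in\mathcal L$, and $\phi^{(t)},x^{(t)},y^{(t)},p^{(t)}$ converge to $\phi^\star,x^\star,y^\star,p^\star$. 3. The welfare suboptimality of this limit outcome is at most $m\max\{0,-\omega^\star\}+\sum_{i,j\in\mathcal L}e_{i,j}$. -/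

import Mathlib

open Set Filter Topology

noncomputable section

namespace RideINP

/-! There are `n = N + 1` locations, indexed by `Fin (N + 1)`.  OD-based adjustments live in
`ℝ^(n-1)`, i.e. `Fin N → ℝ`, the adjustment of the last location being fixed to `0`. -/

/-- The observable market condition `(m, d, c)`: driver supply, trip durations, trip costs. -/
structure MarketCondition (N : ℕ) where
  m : ℝ
  d : Fin (N + 1) → Fin (N + 1) → ℝ
  c : Fin (N + 1) → Fin (N + 1) → ℝ
  m_pos : 0 < m
  d_pos : ∀ i j, 0 < d i j
  c_nonneg : ∀ i j, 0 ≤ c i j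

/-- The rider demand model `q`. Only the restriction of `q i j` to `[0, ∞)` is meaningful; at `0`
derivatives are one-sided.  An economy `(m, d, c, q)` is a `MarketCondition` together with a
`RiderDemand`. -/
structure RiderDemand (N : ℕ) where
  q : Fin (N + 1) → Fin (N + 1) → ℝ → ℝ
  nonneg : ∀ i j r, 0 ≤ r → 0 ≤ q i j r
  contDiffOn : ∀ i j, ContDiffOn ℝ 1 (q i j) (Ici 0)
  deriv_neg : ∀ i j r, 0 ≤ r → derivWithin (q i j) (Ici 0) r < 0
  integrable : ∀ i j, MeasureTheory.IntegrableOn (q i j) (Ioi 0)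

/-- The phantom demand `q̃` by which the platform coordinates driver relocation. -/
structure PhantomDemand {N : ℕ} (K : MarketCondition N) where
  q : Fin (N + 1) → Fin (N + 1) → ℝ → ℝ
  nonneg : ∀ i j r, 0 ≤ r → 0 ≤ q i j r
  contDiffOn : ∀ i j, ContDiffOn ℝ 1 (q i j) (Ici 0)
  antitoneOn : ∀ i j, AntitoneOn (q i j) (Ici 0)
  zero_price : ∀ i j, K.m < K.d i j * q i j 0
  tendsto_zero : ∀ i j, Tendsto (q i j) atTop (𝓝 0)

/-- The slackness `e i j = sup_{r ≥ 0} r * q̃ i j r`, possibly `+∞`. -/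
def PhantomDemand.slack {N : ℕ} {K : MarketCondition N} (P : PhantomDemand K)
    (i j : Fin (N + 1)) : EReal :=
  ⨆ r : Ici (0 : ℝ), (((r : ℝ) * P.q i j r : ℝ) : EReal)

/-- Rider flows, driver flows, and trip prices. -/
structure Outcome (N : ℕ) where
  x : Fin (N + 1) → Fin (N + 1) → ℝ
  y : Fin (N + 1) → Fin (N + 1) → ℝ
  p : Fin (N + 1) → Fin (N + 1) → ℝ

/-- Feasible stationary rider and driver flows. -/
structure IsFeasibleFlow {N : ℕ} (K : MarketCondition N)
    (x y : Fin (N + 1) → Fin (N + 1) → ℝ) : Prop where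
  x_nonneg : ∀ i j, 0 ≤ x i j
  y_nonneg : ∀ i j, 0 ≤ y i j
  x_le_y : ∀ i j, x i j ≤ y i j
  supply : ∑ i, ∑ j, K.d i j * y i j ≤ K.m
  balance : ∀ i, ∑ j, y i j = ∑ j, y j i

/-- Feasible stationary outcomes. -/
structure IsFeasible {N : ℕ} (K : MarketCondition N) (o : Outcome N) : Prop where
  flow : IsFeasibleFlow K o.x o.y
  p_nonneg : ∀ i j, 0 ≤ o.p i j

/-- The value `v i j s` of the `s`-th rider of trip `(i, j)`: the inverse function of
`q i j : [0, ∞) → (0, q i j 0]` (only its values on `(0, q i j 0]` matter). -/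
def RiderDemand.v {N : ℕ} (Q : RiderDemand N) (i j : Fin (N + 1)) : ℝ → ℝ :=
  Function.invFunOn (Q.q i j) (Ici 0)

open Classical in
/-- Social welfare: total value of the riders picked up (in decreasing order of value) minus total
driver cost. It is `-∞` if the rider flow on some trip is outside `[0, q i j 0]`. -/
def welfare {N : ℕ} (K : MarketCondition N) (Q : RiderDemand N)
    (x y : Fin (N + 1) → Fin (N + 1) → ℝ) : EReal :=
  if ∀ i j, x i j ∈ Icc 0 (Q.q i j 0) then
    ((∑ i, ∑ j, ((∫ s in (0 : ℝ)..x i j, Q.v i j s) - K.c i j * y i j) : ℝ) : EReal)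
  else ⊥

/-- The highest social welfare achievable by feasible flows. -/
def optimalWelfare {N : ℕ} (K : MarketCondition N) (Q : RiderDemand N) : EReal :=
  ⨆ (x : Fin (N + 1) → Fin (N + 1) → ℝ) (y : Fin (N + 1) → Fin (N + 1) → ℝ)
    (_ : IsFeasibleFlow K x y), welfare K Q x y

/-- The welfare suboptimality of an outcome. -/
def suboptimality {N : ℕ} (K : MarketCondition N) (Q : RiderDemand N) (o : Outcome N) : EReal :=
  optimalWelfare K Q - welfare K Q o.x o.y

/-- The price structure `p i j = c i j + d i j * π i + φ i - φ j`, with `φ ∈ ℝ^n`. -/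
def price {N : ℕ} (K : MarketCondition N) (φ π : Fin (N + 1) → ℝ) (i j : Fin (N + 1)) : ℝ :=
  K.c i j + K.d i j * π i + φ i - φ j

/-- `(o.x, o.y, o.p, φ, π)` is an origin-based market-clearing outcome (`φ ∈ ℝ^n`). -/
structure IsClearingOutcome {N : ℕ} (K : MarketCondition N) (Q : RiderDemand N)
    (P : PhantomDemand K) (φ π : Fin (N + 1) → ℝ) (o : Outcome N) : Prop where
  feasible : IsFeasible K o
  price_eq : ∀ i j, o.p i j = price K φ π i j
  rider : ∀ i j, o.x i j = Q.q i j (o.p i j)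
  relocation : ∀ i j, o.y i j - o.x i j = P.q i j (o.p i j)
  supply : ∑ i, ∑ j, K.d i j * o.y i j = K.m

/-- The origin-based multipliers `π` clear the market under the adjustments `φ ∈ ℝ^n`. -/
def IsMarketClearing {N : ℕ} (K : MarketCondition N) (Q : RiderDemand N)
    (P : PhantomDemand K) (φ π : Fin (N + 1) → ℝ) : Prop :=
  ∃ o : Outcome N, IsClearingOutcome K Q P φ π o

/-- The vector `(φ_1, …, φ_{n-1}, 0)`. -/
def extend {N : ℕ} (φ : Fin N → ℝ) : Fin (N + 1) → ℝ :=
  Fin.snoc (α := fun _ => ℝ) φ 0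

open Classical in
/-- The map `Π : ℝ^(n-1) → ℝ^n` from OD-based adjustments to market-clearing multipliers
(existence and uniqueness of the latter is part of the main theorem). -/
def multipliers {N : ℕ} (K : MarketCondition N) (Q : RiderDemand N) (P : PhantomDemand K)
    (φ : Fin N → ℝ) : Fin (N + 1) → ℝ :=
  if h : ∃ π, IsMarketClearing K Q P (extend φ) π then h.choose else 0

/-- The outcome induced by adjustments `φ` at the multipliers `Π(φ)`. -/
def outcome {N : ℕ} (K : MarketCondition N) (Q : RiderDemand N) (P : PhantomDemand K)
    (φ : Fin N → ℝ) : Outcome N where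
  x := fun i j => Q.q i j (price K (extend φ) (multipliers K Q P φ) i j)
  y := fun i j => Q.q i j (price K (extend φ) (multipliers K Q P φ) i j)
    + P.q i j (price K (extend φ) (multipliers K Q P φ) i j)
  p := price K (extend φ) (multipliers K Q P φ)

/-- The Lyapunov function `f(φ) = ∑ i, (Π_i(φ) - (1/n) ∑ j, Π_j(φ))^2`. -/
def lyapunov {N : ℕ} (K : MarketCondition N) (Q : RiderDemand N) (P : PhantomDemand K)
    (φ : Fin N → ℝ) : ℝ :=
  ∑ i, (multipliers K Q P φ i - (1 / ((N : ℝ) + 1)) * ∑ j, multipliers K Q P φ j) ^ 2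

/-- The `n × n` matrix `[-DΠ(φ)  1_n]`. -/
def newtonMatrix {N : ℕ} (K : MarketCondition N) (Q : RiderDemand N) (P : PhantomDemand K)
    (φ : Fin N → ℝ) : Matrix (Fin (N + 1)) (Fin (N + 1)) ℝ :=
  Matrix.of fun i => Fin.snoc (α := fun _ => ℝ)
    (fun j : Fin N => - fderiv ℝ (multipliers K Q P) φ (Pi.single j 1) i) 1

/-- The direction `δ = ([-DΠ(φ)  1_n]⁻¹ Π(φ))_{1:n-1}`. -/
def direction {N : ℕ} (K : MarketCondition N) (Q : RiderDemand N) (P : PhantomDemand K)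
    (φ : Fin N → ℝ) : Fin N → ℝ :=
  fun j => ((newtonMatrix K Q P φ)⁻¹.mulVec (multipliers K Q P φ)) j.castSucc

open Classical in
/-- The stepsize `min {1, τ / ‖DΠ(φ) δ‖_∞}`, equal to `1` if the norm vanishes. The norm on
`Fin (N + 1) → ℝ` is the sup norm. -/
def stepsize {N : ℕ} (K : MarketCondition N) (Q : RiderDemand N) (P : PhantomDemand K)
    (τ : ℝ) (φ δ : Fin N → ℝ) : ℝ :=
  if ‖fderiv ℝ (multipliers K Q P) φ δ‖ = 0 then 1
  else min 1 (τ / ‖fderiv ℝ (multipliers K Q P) φ δ‖)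

/-- The state of the INP mechanism after time `t`: `adj` is `φ^(t)`, `base` is `φ^(t')` where `t'`
is the timestep prior to the most recent update of the direction, `dir` is `δ^(t)` and `step` is
`α^(t)`. -/
structure INPState (N : ℕ) where
  adj : Fin N → ℝ
  base : Fin N → ℝ
  dir : Fin N → ℝ
  step : ℝ

/-- The state resulting from a new direction computed at the adjustments `φ`. -/
def newDirection {N : ℕ} (K : MarketCondition N) (Q : RiderDemand N) (P : PhantomDemand K)
    (τ : ℝ) (φ : Fin N → ℝ) : INPState N where
  adj := φ + stepsize K Q P τ φ (direction K Q P φ) • direction K Q P φ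
  base := φ
  dir := direction K Q P φ
  step := stepsize K Q P τ φ (direction K Q P φ)

/-- The state resulting from backtracking. -/
def backtrack {N : ℕ} (β : ℝ) (s : INPState N) : INPState N where
  adj := s.base + (β * s.step) • s.dir
  base := s.base
  dir := s.dir
  step := β * s.step

/-- Sufficient progress in `f`:
`f(φ^(t)) < f(φ^(t')) + σ ∇f(φ^(t'))ᵀ (α^(t) δ^(t))`. -/
def SufficientProgress {N : ℕ} (K : MarketCondition N) (Q : RiderDemand N) (P : PhantomDemand K)
    (σ : ℝ) (s : INPState N) : Prop :=
  lyapunov K Q P s.adj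
    < lyapunov K Q P s.base + σ * fderiv ℝ (lyapunov K Q P) s.base (s.step • s.dir)

open Classical in
/-- The INP mechanism with parameters `τ, β, σ` in the stationary economy `(K, Q)` with phantom
demand `P`, started without adjustments. (The components of the initial state other than `adj` are
never used.) -/
def inpState {N : ℕ} (K : MarketCondition N) (Q : RiderDemand N) (P : PhantomDemand K)
    (τ β σ : ℝ) : ℕ → INPState N
  | 0 => ⟨0, 0, 0, 0⟩
  | t + 1 =>
    if t = 0 ∨ SufficientProgress K Q P σ (inpState K Q P τ β σ t) then
      newDirection K Q P τ (inpState K Q P τ β σ t).adj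
    else backtrack β (inpState K Q P τ β σ t)

/-- The adjustments `φ^(t)` of the INP mechanism. -/
def inpAdj {N : ℕ} (K : MarketCondition N) (Q : RiderDemand N) (P : PhantomDemand K)
    (τ β σ : ℝ) (t : ℕ) : Fin N → ℝ :=
  (inpState K Q P τ β σ t).adj

/-- What the platform observes during a timestep: the origin-based market-clearing outcome
`(x, y, p, φ, π)` and the local price sensitivities `q'_{i,j}(p_{i,j})`. -/
structure Observation (N : ℕ) where
  out : Outcome N
  φ : Fin N → ℝ
  π : Fin (N + 1) → ℝ
  sens : Fin (N + 1) → Fin (N + 1) → ℝ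

/-- The observation made under the adjustments `φ`. -/
def observe {N : ℕ} (K : MarketCondition N) (Q : RiderDemand N) (P : PhantomDemand K)
    (φ : Fin N → ℝ) : Observation N where
  out := outcome K Q P φ
  φ := φ
  π := multipliers K Q P φ
  sens := fun i j => derivWithin (Q.q i j) (Ici 0) ((outcome K Q P φ).p i j)

/-- The history `h_t` under the INP mechanism: the observations of the timesteps `0, …, t - 1`. -/
def inpHistory {N : ℕ} (K : MarketCondition N) (Q : RiderDemand N) (P : PhantomDemand K)
    (τ β σ : ℝ) (t : ℕ) : Fin t → Observation N :=
  fun s => observe K Q P (inpAdj K Q P τ β σ s)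

/-- An iterative pricing mechanism: a rule choosing `φ^(t)` from the history `h_t`, starting with
`φ^(0) = 0`. (The market condition `(m, d, c)` and the phantom demand are known to the platform, so
a rule may be chosen depending on them, but not on the rider demand.) -/
structure IterativePricingMechanism (N : ℕ) where
  rule : (t : ℕ) → (Fin t → Observation N) → Fin N → ℝ
  rule_zero : ∀ h, rule 0 h = 0

end RideINP

end

/-! The prices of an origin-based market-clearing outcome depend on the multiplier of the origin
only, so that raising the multipliers of a set of locations lowers the flows out of it. This gives
a comparison principle for balanced flows (`nonpos_of_balanced_of_supply`), whose nonlinear form is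
the uniqueness of market-clearing multipliers and whose linearized form is the invertibility of the
partial derivative of the clearing equations in the multipliers. Existence of the multipliers comes
from a map that moves drivers along their trips: it preserves order and mass, hence is nonexpansive
for the `ℓ¹`-norm on the simplex of driver distributions, and its fixed points are the balanced
flows (`exists_balanced_of_monotone`, `exists_isMarketClearing`). As phantom demand at price `0`
exceeds the supply, clearing prices are positive, all functions involved are differentiable there,
and the implicit function theorem makes `Π` continuously differentiable.

If a change of adjustments changes all multipliers equally, then the changes `dy`, `dp` of flows and
prices satisfy `∑ dy * dp = 0`, while demand slopes downward; so `dp = 0` and the change is zero.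
This is the invertibility of the Newton matrix (`newtonMatrix_isUnit_det`); the same computation
with differences in place of derivatives shows that at most one `φ` equalizes the multipliers. The
Newton direction `δ` satisfies `Π + DΠ δ = const`, whence `∇f · δ = -2 f`. The sublevel sets of `f`
are compact, because some multiplier is bounded uniformly in `φ` (`exists_multipliers_le`), and a
standard argument on backtracking line search (`tendsto_of_backtracking`) gives convergence to the
zero of `f`.

The welfare bound is weak duality: the limit prices are dual variables of the welfare optimization
problem, complementary slackness fails by `∑ p * q̃ p ≤ ∑ e` only, and the unused supply costs
`m * max 0 (-ω)` when `ω` is negative. The mechanism does not need to know rider demand, as `DΠ` is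
the solution of a linear system in the observed slopes (`fderiv_multipliers_eq_of_observe_eq`). -/

namespace RideINP

variable {N : ℕ} {K : MarketCondition N}

/-! ### Demand functions -/

lemma RiderDemand.strictAntiOn (Q : RiderDemand N) (i j : Fin (N + 1)) :
    StrictAntiOn (Q.q i j) (Ici 0) := by
  refine strictAntiOn_of_deriv_neg (convex_Ici 0) (Q.contDiffOn i j).continuousOn fun r hr => ?_
  rw [interior_Ici] at hr
  rw [← derivWithin_of_mem_nhds (Ici_mem_nhds hr)]
  exact Q.deriv_neg i j r (mem_Ioi.1 hr).le

lemma RiderDemand.pos (Q : RiderDemand N) (i j : Fin (N + 1)) {r : ℝ} (hr : 0 ≤ r) :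
    0 < Q.q i j r :=
  (Q.nonneg i j (r + 1) (by linarith)).trans_lt
    (Q.strictAntiOn i j hr (show (0 : ℝ) ≤ r + 1 by linarith) (by linarith))

/-- A nonnegative decreasing integrable function vanishes at infinity: `r * q r ≤ ∫ q`. -/
lemma RiderDemand.tendsto_zero (Q : RiderDemand N) (i j : Fin (N + 1)) :
    Tendsto (Q.q i j) atTop (𝓝 0) := by
  have hbound : ∀ r : ℝ, 0 < r → Q.q i j r ≤ (∫ s in Ioi (0 : ℝ), Q.q i j s) / r := by
    intro r hr
    rw [le_div_iff₀ hr]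
    have h1 : ∫ s in Ioc (0 : ℝ) r, Q.q i j r ≤ ∫ s in Ioc (0 : ℝ) r, Q.q i j s := by
      refine MeasureTheory.setIntegral_mono_on (by simp)
        ((Q.integrable i j).mono_set Ioc_subset_Ioi_self) measurableSet_Ioc fun s hs => ?_
      exact (Q.strictAntiOn i j).antitoneOn (mem_Ici.2 hs.1.le) (mem_Ici.2 hr.le) hs.2
    have h2 : ∫ s in Ioc (0 : ℝ) r, Q.q i j s ≤ ∫ s in Ioi (0 : ℝ), Q.q i j s := by
      refine MeasureTheory.setIntegral_mono_set (Q.integrable i j) ?_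
        (Ioc_subset_Ioi_self.eventuallyLE)
      refine (MeasureTheory.ae_restrict_iff' measurableSet_Ioi).2 (Eventually.of_forall ?_)
      exact fun s hs => Q.nonneg i j s (le_of_lt hs)
    have h3 : ∫ s in Ioc (0 : ℝ) r, Q.q i j r = Q.q i j r * r := by
      simp [hr.le, mul_comm]
    linarith
  refine squeeze_zero' ((eventually_ge_atTop 0).mono fun r hr => Q.nonneg i j r hr)
    ((eventually_gt_atTop 0).mono hbound) (tendsto_const_nhds.div_atTop tendsto_id)

/-- Driver demand for a trip at a given price: riders plus phantom riders. -/
noncomputable def totalDemand (Q : RiderDemand N) (P : PhantomDemand K) (i j : Fin (N + 1))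
    (r : ℝ) : ℝ :=
  Q.q i j r + P.q i j r

/-- The derivative of `totalDemand` on `[0, ∞)`, one-sided at `0`. -/
noncomputable def demandSlope (Q : RiderDemand N) (P : PhantomDemand K) (i j : Fin (N + 1))
    (r : ℝ) : ℝ :=
  derivWithin (Q.q i j) (Ici 0) r + derivWithin (P.q i j) (Ici 0) r

section

variable (Q : RiderDemand N) (P : PhantomDemand K) (i j : Fin (N + 1))

lemma totalDemand_strictAntiOn : StrictAntiOn (totalDemand Q P i j) (Ici 0) :=
  fun _ ha _ hb hab => add_lt_add_of_lt_of_le (Q.strictAntiOn i j ha hb hab)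
    (P.antitoneOn i j ha hb hab.le)

lemma totalDemand_pos {r : ℝ} (hr : 0 ≤ r) : 0 < totalDemand Q P i j r :=
  add_pos_of_pos_of_nonneg (Q.pos i j hr) (P.nonneg i j r hr)

lemma totalDemand_contDiffOn : ContDiffOn ℝ 1 (totalDemand Q P i j) (Ici 0) :=
  (Q.contDiffOn i j).add (P.contDiffOn i j)

lemma totalDemand_tendsto_zero : Tendsto (totalDemand Q P i j) atTop (𝓝 0) := by
  have h := (Q.tendsto_zero i j).add (P.tendsto_zero i j)
  rwa [add_zero] at h

lemma lt_mul_totalDemand_zero : K.m < K.d i j * totalDemand Q P i j 0 := by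
  have h := mul_nonneg (K.d_pos i j).le (Q.nonneg i j 0 le_rfl)
  have := P.zero_price i j
  rw [totalDemand, mul_add]
  linarith

lemma demandSlope_neg {r : ℝ} (hr : 0 ≤ r) : demandSlope Q P i j r < 0 :=
  add_neg_of_neg_of_nonpos (Q.deriv_neg i j r hr) (P.antitoneOn i j).derivWithin_nonpos

lemma totalDemand_hasDerivAt {r : ℝ} (hr : 0 < r) :
    HasDerivAt (totalDemand Q P i j) (demandSlope Q P i j r) r := by
  have h1 := ((Q.contDiffOn i j).differentiableOn one_ne_zero r hr.le).hasDerivWithinAt.hasDerivAt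
    (Ici_mem_nhds hr)
  have h2 := ((P.contDiffOn i j).differentiableOn one_ne_zero r hr.le).hasDerivWithinAt.hasDerivAt
    (Ici_mem_nhds hr)
  exact h1.add h2

lemma totalDemand_contDiffAt {r : ℝ} (hr : 0 < r) : ContDiffAt ℝ 1 (totalDemand Q P i j) r :=
  (totalDemand_contDiffOn Q P i j).contDiffAt (Ici_mem_nhds hr)

end

/-! ### Balanced flows -/

section Balanced

variable {ι : Type*} [Fintype ι]

/-- In a balanced flow, the outflow of every set of locations equals its inflow. -/
lemma sum_cut_eq_of_balanced [DecidableEq ι] {z : ι → ι → ℝ} (hz : ∀ i, ∑ j, z i j = ∑ j, z j i)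
    (s : Finset ι) : ∑ i ∈ s, ∑ j ∈ sᶜ, z i j = ∑ i ∈ s, ∑ j ∈ sᶜ, z j i := by
  have h1 : ∑ i ∈ s, ∑ j, z i j = ∑ i ∈ s, ∑ j, z j i := Finset.sum_congr rfl fun i _ => hz i
  simp only [← Finset.sum_add_sum_compl s, Finset.sum_add_distrib] at h1
  have h2 : ∑ i ∈ s, ∑ j ∈ s, z i j = ∑ i ∈ s, ∑ j ∈ s, z j i := Finset.sum_comm
  linarith

/-- Potential differences have no net effect on a balanced flow. -/
lemma sum_potential_mul_of_balanced {z : ι → ι → ℝ} (hz : ∀ i, ∑ j, z i j = ∑ j, z j i)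
    (a : ι → ℝ) : ∑ i, ∑ j, (a i - a j) * z i j = 0 := by
  have h1 : ∑ i, ∑ j, a i * z i j = ∑ i, ∑ j, a j * z i j := by
    rw [Finset.sum_comm (f := fun i j => a j * z i j)]
    simp only [← Finset.mul_sum, hz]
  simp only [sub_mul, Finset.sum_sub_distrib, h1, sub_self]

/-- Comparison principle for origin-based multipliers. Here `z` is a change of flows caused by a
change `θ` of the multipliers: if the multiplier of `i` goes up, all flows out of `i` go down, and
otherwise they do not. Were some but not all multipliers to go up, the set of their locations
would lose outflow but not inflow. -/
lemma nonpos_of_balanced_of_supply {d z : ι → ι → ℝ} {θ : ι → ℝ} (hd : ∀ i j, 0 < d i j)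
    (hz : ∀ i, ∑ j, z i j = ∑ j, z j i) (hs : ∑ i, ∑ j, d i j * z i j = 0)
    (hpos : ∀ i, 0 < θ i → ∀ j, z i j < 0) (hnonpos : ∀ i, θ i ≤ 0 → ∀ j, 0 ≤ z i j) (i : ι) :
    θ i ≤ 0 := by
  classical
  by_contra! hi
  set s : Finset ι := Finset.univ.filter fun k => 0 < θ k with hsdef
  have hmem : ∀ k, k ∈ s ↔ 0 < θ k := fun k => by simp [hsdef]
  have his : i ∈ s := (hmem i).2 hi
  by_cases hall : sᶜ.Nonempty
  · obtain ⟨k, hk⟩ := hall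
    have hcut := sum_cut_eq_of_balanced hz s
    have h1 : ∑ i ∈ s, ∑ j ∈ sᶜ, z i j < 0 :=
      Finset.sum_neg (fun i hi => Finset.sum_neg (fun j _ => hpos i ((hmem i).1 hi) j) ⟨k, hk⟩)
        ⟨i, his⟩
    have h2 : 0 ≤ ∑ i ∈ s, ∑ j ∈ sᶜ, z j i :=
      Finset.sum_nonneg fun i _ => Finset.sum_nonneg fun j hj => hnonpos j
        (not_lt.1 fun h => (Finset.mem_compl.1 hj) ((hmem j).2 h)) i
    linarith
  · have hall' : ∀ k, 0 < θ k := fun k => by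
      by_contra h
      exact hall ⟨k, Finset.mem_compl.2 fun hk => h ((hmem k).1 hk)⟩
    have : ∑ i, ∑ j, d i j * z i j < 0 :=
      Finset.sum_neg (fun i _ => Finset.sum_neg
        (fun j _ => mul_neg_of_pos_of_neg (hd i j) (hpos i (hall' i) j)) ⟨i, Finset.mem_univ i⟩)
        ⟨i, Finset.mem_univ i⟩
    linarith

end Balanced

/-! ### Existence of balanced flows -/

/-- A nonexpansive self-map of a nonempty compact convex set has a fixed point: it is a limit of
the contractions `(1 - ε) T + ε b`. -/
lemma exists_fixedPoint_of_nonexpansive {E : Type*} [NormedAddCommGroup E] [NormedSpace ℝ E]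
    {s : Set E} (hs : IsCompact s) (hc : Convex ℝ s) (hne : s.Nonempty) {T : E → E}
    (hT : MapsTo T s s) (hdist : ∀ x ∈ s, ∀ y ∈ s, dist (T x) (T y) ≤ dist x y) :
    ∃ x ∈ s, T x = x := by
  obtain ⟨b, hb⟩ := hne
  have hcont : ContinuousOn T s :=
    (LipschitzOnWith.of_dist_le_mul (K := 1) fun x hx y hy => by
      simpa using hdist x hx y hy).continuousOn
  obtain ⟨x, hx, hmin⟩ := hs.exists_isMinOn (f := fun y => dist (T y) y) ⟨b, hb⟩
    (continuous_dist.comp_continuousOn (hcont.prodMk continuousOn_id))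
  refine ⟨x, hx, ?_⟩
  obtain ⟨C, hC⟩ := hs.isBounded.exists_norm_le
  have key : ∀ ε : ℝ, 0 < ε → ε < 1 → dist (T x) x ≤ ε * (2 * C) := by
    intro ε hε hε1
    have hmaps : MapsTo (fun y => (1 - ε) • T y + ε • b) s s := fun y hy =>
      hc (hT hy) hb (by linarith) hε.le (by ring)
    have hcontr : ContractingWith (1 - ε).toNNReal (hmaps.restrict _ s s) := by
      refine ⟨by simpa using hε, LipschitzWith.of_dist_le_mul fun y z => ?_⟩
      rw [Real.coe_toNNReal _ (by linarith : (0 : ℝ) ≤ 1 - ε)]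
      simp only [Subtype.dist_eq, MapsTo.val_restrict_apply, dist_add_right, dist_smul₀,
        Real.norm_of_nonneg (by linarith : (0 : ℝ) ≤ 1 - ε)]
      exact mul_le_mul_of_nonneg_left (hdist _ y.2 _ z.2) (by linarith)
    obtain ⟨y, hy, hfix, -⟩ := hcontr.exists_fixedPoint' hs.isComplete hmaps hb (edist_ne_top _ _)
    have hfix' : (1 - ε) • T y + ε • b = y := hfix
    have h1 : T y - y = ε • (T y - b) := by
      nth_rewrite 2 [← hfix']
      module
    calc dist (T x) x ≤ dist (T y) y := hmin hy
      _ = ε * ‖T y - b‖ := by rw [dist_eq_norm, h1, norm_smul, Real.norm_of_nonneg hε.le]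
      _ ≤ ε * (2 * C) := by
        have := norm_sub_le (T y) b
        have := hC _ (hT hy)
        have := hC _ hb
        gcongr
        linarith
  have hlim : Tendsto (fun ε : ℝ => ε * (2 * C)) (𝓝[>] 0) (𝓝 0) := by
    have : Tendsto (fun ε : ℝ => ε * (2 * C)) (𝓝 0) (𝓝 (0 * (2 * C))) :=
      (continuous_id.mul continuous_const).tendsto 0
    rw [zero_mul] at this
    exact this.mono_left nhdsWithin_le_nhds
  have : dist (T x) x ≤ 0 := by
    refine ge_of_tendsto hlim ?_
    filter_upwards [Ioo_mem_nhdsGT (zero_lt_one (α := ℝ))] with ε hε using key ε hε.1 hε.2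
  exact dist_le_zero.1 this

/-- Existence of balanced flows. Out of `i`, the flows `h i j` are increasing functions of the
number `u i` of drivers on trips from `i`. The map that moves drivers at rate `κ` along the flows
is order preserving and preserves the total number of drivers, hence is nonexpansive for the
`ℓ¹`-norm; its fixed points are the balanced flows. -/
lemma exists_balanced_of_monotone {ι : Type*} [Fintype ι] [Nonempty ι] {d : ι → ι → ℝ} {m : ℝ}
    (hm : 0 < m) (hd : ∀ i j, 0 < d i j) {h : ι → ι → ℝ → ℝ}
    (hmono : ∀ i j, MonotoneOn (h i j) (Icc 0 m)) (hnonneg : ∀ i j, ∀ s ∈ Icc 0 m, 0 ≤ h i j s)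
    (hsum : ∀ i, ∀ s ∈ Icc 0 m, ∑ j, d i j * h i j s = s) :
    ∃ u : ι → ℝ, (∀ i, u i ∈ Icc 0 m) ∧ ∑ i, u i = m ∧
      ∀ i, ∑ j, h i j (u i) = ∑ j, h j i (u j) := by
  classical
  obtain ⟨κ, hκ, hκd⟩ : ∃ κ : ℝ, 0 < κ ∧ ∀ i j, κ ≤ d i j := by
    obtain ⟨a, ha⟩ := Finite.exists_min fun a : ι × ι => d a.1 a.2
    exact ⟨d a.1 a.2, hd _ _, fun i j => ha (i, j)⟩
  set T : (ι → ℝ) → ι → ℝ := fun u i =>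
    ∑ j, (d i j - κ) * h i j (u i) + κ * ∑ j, h j i (u j) with hTdef
  have hTmono : ∀ u w : ι → ℝ, (∀ i, u i ∈ Icc 0 m) → (∀ i, w i ∈ Icc 0 m) → u ≤ w →
      T u ≤ T w := by
    intro u w hu hw huw i
    refine add_le_add (Finset.sum_le_sum fun j _ => ?_) (mul_le_mul_of_nonneg_left
      (Finset.sum_le_sum fun j _ => hmono j i (hu j) (hw j) (huw j)) hκ.le)
    exact mul_le_mul_of_nonneg_left (hmono i j (hu i) (hw i) (huw i)) (sub_nonneg.2 (hκd i j))
  have hTsum : ∀ u : ι → ℝ, (∀ i, u i ∈ Icc 0 m) → ∑ i, T u i = ∑ i, u i := by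
    intro u hu
    have h1 : ∀ i, ∑ j, (d i j - κ) * h i j (u i) = u i - κ * ∑ j, h i j (u i) := fun i => by
      simp only [sub_mul, Finset.sum_sub_distrib, hsum i _ (hu i), Finset.mul_sum]
    simp only [hTdef, h1, Finset.sum_add_distrib, Finset.sum_sub_distrib, ← Finset.mul_sum]
    rw [Finset.sum_comm (f := fun i j => h j i (u j))]
    ring
  have hTnonneg : ∀ u : ι → ℝ, (∀ i, u i ∈ Icc 0 m) → ∀ i, 0 ≤ T u i := fun u hu i =>
    add_nonneg (Finset.sum_nonneg fun j _ => mul_nonneg (sub_nonneg.2 (hκd i j))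
      (hnonneg i j _ (hu i))) (mul_nonneg hκ.le (Finset.sum_nonneg fun j _ => hnonneg j i _ (hu j)))
  have hbox : ∀ u : ι → ℝ, (∀ i, 0 ≤ u i) → ∑ i, u i = m → ∀ i, u i ∈ Icc 0 m := fun u hu hs i =>
    ⟨hu i, hs ▸ Finset.single_le_sum (f := u) (fun j _ => hu j) (Finset.mem_univ i)⟩
  set S : Set (PiLp 1 fun _ : ι => ℝ) := {u | (∀ i, 0 ≤ u i) ∧ ∑ i, u i = m} with hSdef
  have hSc : IsCompact S := by
    have himg : S = WithLp.toLp 1 '' {u : ι → ℝ | (∀ i, 0 ≤ u i) ∧ ∑ i, u i = m} := by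
      ext u
      exact ⟨fun hu => ⟨u.ofLp, hu, rfl⟩, by rintro ⟨v, hv, rfl⟩; exact hv⟩
    rw [himg]
    refine IsCompact.image ?_ (PiLp.continuous_toLp 1 _)
    refine (isCompact_univ_pi fun _ : ι => isCompact_Icc (a := (0 : ℝ)) (b := m)).of_isClosed_subset
      ?_ fun u hu i _ => hbox u hu.1 hu.2 i
    exact (isClosed_Ici (a := (0 : ι → ℝ))).inter
      (isClosed_eq (continuous_finsetSum _ fun i _ => continuous_apply i) continuous_const)
  have hSconv : Convex ℝ S := by
    intro u hu v hv a b ha hb hab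
    refine ⟨fun i => ?_, ?_⟩
    · simpa using add_nonneg (mul_nonneg ha (hu.1 i)) (mul_nonneg hb (hv.1 i))
    · simp only [PiLp.add_apply, PiLp.smul_apply, smul_eq_mul, Finset.sum_add_distrib,
        ← Finset.mul_sum, hu.2, hv.2, ← add_mul, hab, one_mul]
  have hSne : S.Nonempty := by
    obtain ⟨k⟩ := ‹Nonempty ι›
    refine ⟨WithLp.toLp 1 (Pi.single k m), fun i => ?_, by simp⟩
    by_cases hik : i = k
    · subst hik; simpa using hm.le
    · simp [hik]
  obtain ⟨u, hu, hfix⟩ := exists_fixedPoint_of_nonexpansive hSc hSconv hSne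
    (T := fun u => WithLp.toLp 1 (T u.ofLp))
    (fun u hu => ⟨fun i => hTnonneg _ (hbox _ hu.1 hu.2) i,
      (hTsum _ (hbox _ hu.1 hu.2)).trans hu.2⟩) (by
      intro u hu v hv
      have hu' := hbox _ hu.1 hu.2
      have hv' := hbox _ hv.1 hv.2
      -- compare both images with that of the supremum, which may have more mass than `m`
      set w : ι → ℝ := u.ofLp ⊔ v.ofLp with hw
      have hw' : ∀ i, w i ∈ Icc 0 m := fun i =>
        ⟨le_sup_of_le_left (hu' i).1, sup_le (hu' i).2 (hv' i).2⟩
      have h1 := hTmono _ w hu' hw' le_sup_left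
      have h2 := hTmono _ w hv' hw' le_sup_right
      rw [PiLp.dist_eq_of_L1, PiLp.dist_eq_of_L1]
      calc ∑ i, dist (T u.ofLp i) (T v.ofLp i)
          ≤ ∑ i, ((T w i - T u.ofLp i) + (T w i - T v.ofLp i)) := by
            refine Finset.sum_le_sum fun i _ => ?_
            rw [Real.dist_eq, abs_le]
            constructor <;> linarith [h1 i, h2 i]
        _ = ∑ i, ((w i - u i) + (w i - v i)) := by
            simp only [Finset.sum_add_distrib, Finset.sum_sub_distrib, hTsum _ hw', hTsum _ hu',
              hTsum _ hv']
        _ = ∑ i, dist (u i) (v i) := by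
            refine Finset.sum_congr rfl fun i _ => ?_
            rw [Real.dist_eq]
            have : w i = max (u i) (v i) := rfl
            rcases le_total (u i) (v i) with h | h
            · rw [this, max_eq_right h, abs_of_nonpos (by linarith)]; ring
            · rw [this, max_eq_left h, abs_of_nonneg (by linarith)]; ring)
  have hu' := hbox _ hu.1 hu.2
  refine ⟨u.ofLp, hu', hu.2, fun i => ?_⟩
  have h1 : T u.ofLp i = u i := congrArg (fun v : PiLp 1 fun _ : ι => ℝ => v i) hfix
  have h2 : ∑ j, (d i j - κ) * h i j (u i) = u i - κ * ∑ j, h i j (u i) := by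
    simp only [sub_mul, Finset.sum_sub_distrib, hsum i _ (hu' i), Finset.mul_sum]
  simp only [hTdef, h2] at h1
  have : κ * ∑ j, h i j (u i) = κ * ∑ j, h j i (u j) := by linarith
  exact mul_left_cancel₀ hκ.ne' this

/-! ### Existence and uniqueness of market-clearing multipliers -/

section

variable (Q : RiderDemand N) (P : PhantomDemand K)

/-- The driver flows `y` induced by adjustments `φ` and multipliers `π`. -/
noncomputable def driverFlow (φ π : Fin (N + 1) → ℝ) (i j : Fin (N + 1)) : ℝ :=
  totalDemand Q P i j (price K φ π i j)

/-- At market-clearing multipliers no trip is free, as `q̃ i j 0` alone exceeds the supply of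
drivers. -/
lemma pos_of_mul_totalDemand_le {i j : Fin (N + 1)} {r : ℝ} (hr : 0 ≤ r)
    (h : K.d i j * totalDemand Q P i j r ≤ K.m) : 0 < r := by
  refine hr.lt_of_ne fun h0 => ?_
  subst h0
  exact (lt_mul_totalDemand_zero Q P i j).not_ge h

variable {Q P}

lemma isMarketClearing_iff {φ π : Fin (N + 1) → ℝ} :
    IsMarketClearing K Q P φ π ↔ (∀ i j, 0 < price K φ π i j) ∧
      (∀ i, ∑ j, driverFlow Q P φ π i j = ∑ j, driverFlow Q P φ π j i) ∧
      ∑ i, ∑ j, K.d i j * driverFlow Q P φ π i j = K.m := by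
  constructor
  · rintro ⟨o, ho⟩
    have hy : ∀ i j, o.y i j = driverFlow Q P φ π i j := fun i j => by
      rw [driverFlow, totalDemand, ← ho.price_eq, ← ho.rider, ← ho.relocation]
      ring
    have hbal := ho.feasible.flow.balance
    have hsup := ho.supply
    simp only [hy] at hbal hsup
    refine ⟨fun i j => ?_, hbal, hsup⟩
    have hp : 0 ≤ price K φ π i j := ho.price_eq i j ▸ ho.feasible.p_nonneg i j
    refine pos_of_mul_totalDemand_le Q P hp (i := i) (j := j) ?_
    have hnn : ∀ k l, 0 ≤ K.d k l * driverFlow Q P φ π k l := fun k l =>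
      mul_nonneg (K.d_pos k l).le (hy k l ▸ ho.feasible.flow.y_nonneg k l)
    calc K.d i j * driverFlow Q P φ π i j ≤ ∑ j, K.d i j * driverFlow Q P φ π i j :=
          Finset.single_le_sum (f := fun j => K.d i j * driverFlow Q P φ π i j)
            (fun l _ => hnn i l) (Finset.mem_univ j)
      _ ≤ ∑ i, ∑ j, K.d i j * driverFlow Q P φ π i j :=
          Finset.single_le_sum (f := fun i => ∑ j, K.d i j * driverFlow Q P φ π i j)
            (fun k _ => Finset.sum_nonneg fun l _ => hnn k l) (Finset.mem_univ i)
      _ = K.m := hsup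
  · rintro ⟨hp, hbal, hsup⟩
    refine ⟨⟨fun i j => Q.q i j (price K φ π i j), driverFlow Q P φ π, price K φ π⟩,
      ⟨⟨fun i j => Q.nonneg i j _ (hp i j).le, fun i j => (totalDemand_pos Q P i j (hp i j).le).le,
        fun i j => ?_, hsup.le, hbal⟩, fun i j => (hp i j).le⟩, fun _ _ => rfl, fun _ _ => rfl,
        fun i j => ?_, hsup⟩
    · exact le_add_of_nonneg_right (P.nonneg i j _ (hp i j).le)
    · exact add_sub_cancel_left _ _

lemma IsMarketClearing.price_pos {φ π : Fin (N + 1) → ℝ} (h : IsMarketClearing K Q P φ π)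
    (i j : Fin (N + 1)) : 0 < price K φ π i j :=
  (isMarketClearing_iff.1 h).1 i j

lemma IsMarketClearing.balance {φ π : Fin (N + 1) → ℝ} (h : IsMarketClearing K Q P φ π)
    (i : Fin (N + 1)) : ∑ j, driverFlow Q P φ π i j = ∑ j, driverFlow Q P φ π j i :=
  (isMarketClearing_iff.1 h).2.1 i

lemma IsMarketClearing.supply {φ π : Fin (N + 1) → ℝ} (h : IsMarketClearing K Q P φ π) :
    ∑ i, ∑ j, K.d i j * driverFlow Q P φ π i j = K.m :=
  (isMarketClearing_iff.1 h).2.2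

lemma IsMarketClearing.flow_pos {φ π : Fin (N + 1) → ℝ} (h : IsMarketClearing K Q P φ π)
    (i j : Fin (N + 1)) : 0 < driverFlow Q P φ π i j :=
  totalDemand_pos Q P i j (h.price_pos i j).le

/-- Differences of balanced flows are balanced. -/
lemma sub_balanced {ι : Type*} [Fintype ι] {y z : ι → ι → ℝ} (hy : ∀ i, ∑ j, y i j = ∑ j, y j i)
    (hz : ∀ i, ∑ j, z i j = ∑ j, z j i) (i : ι) :
    ∑ j, (y i j - z i j) = ∑ j, (y j i - z j i) := by
  simp only [Finset.sum_sub_distrib, hy, hz]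

lemma IsMarketClearing.le {φ π π' : Fin (N + 1) → ℝ} (h : IsMarketClearing K Q P φ π)
    (h' : IsMarketClearing K Q P φ π') : π ≤ π' := by
  intro i
  refine sub_nonpos.1 (nonpos_of_balanced_of_supply (θ := fun i => π i - π' i) K.d_pos
    (sub_balanced h.balance h'.balance) ?_ (fun i hi j => sub_neg.2 ?_)
    (fun i hi j => sub_nonneg.2 ?_) i)
  · simp only [mul_sub, Finset.sum_sub_distrib, h.supply, h'.supply, sub_self]
  · refine totalDemand_strictAntiOn Q P i j (h'.price_pos i j).le (h.price_pos i j).le ?_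
    have := mul_pos (K.d_pos i j) hi
    simp only [price]
    linarith
  · refine (totalDemand_strictAntiOn Q P i j).antitoneOn (h.price_pos i j).le
      (h'.price_pos i j).le ?_
    have := mul_nonneg (K.d_pos i j).le (sub_nonneg.2 (sub_nonpos.1 hi))
    simp only [price]
    linarith

lemma IsMarketClearing.unique {φ π π' : Fin (N + 1) → ℝ} (h : IsMarketClearing K Q P φ π)
    (h' : IsMarketClearing K Q P φ π') : π = π' :=
  le_antisymm (h.le h') (h'.le h)

variable (Q P)

lemma exists_isMarketClearing (φ : Fin (N + 1) → ℝ) : ∃ π, IsMarketClearing K Q P φ π := by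
  -- demand is continued by a constant to negative prices; such prices do not occur at a solution
  set H : Fin (N + 1) → Fin (N + 1) → ℝ → ℝ := fun i j t =>
    totalDemand Q P i j (max (K.c i j + K.d i j * t + φ i - φ j) 0) with hH
  have hHpos : ∀ i j t, 0 < H i j t := fun i j t => totalDemand_pos Q P i j (le_max_right _ _)
  have hHcont : ∀ i j, Continuous (H i j) := fun i j =>
    (totalDemand_contDiffOn Q P i j).continuousOn.comp_continuous (by fun_prop)
      fun t => mem_Ici.2 (le_max_right _ _)
  have hHanti : ∀ i j, Antitone (H i j) := fun i j s t hst =>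
    (totalDemand_strictAntiOn Q P i j).antitoneOn (mem_Ici.2 (le_max_right _ _))
      (mem_Ici.2 (le_max_right _ _)) (max_le_max_right 0 (by
        have := mul_le_mul_of_nonneg_left hst (K.d_pos i j).le
        linarith))
  have hHzero : ∀ i j, Tendsto (H i j) atTop (𝓝 0) := fun i j => by
    refine (totalDemand_tendsto_zero Q P i j).comp (tendsto_atTop_mono (fun t => le_max_left _ _) ?_)
    have h1 : Tendsto (fun t : ℝ => K.d i j * t) atTop atTop :=
      tendsto_id.const_mul_atTop (K.d_pos i j)
    refine (tendsto_atTop_add_const_right _ (K.c i j + φ i - φ j) h1).congr fun t => ?_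
    ring
  -- `t i s` is the multiplier of `i` at which `s` drivers are on trips from `i`
  have hex : ∀ i, ∀ s ∈ Ioc 0 K.m, ∃ t, ∑ j, K.d i j * H i j t = s := by
    intro i s hs
    refine mem_range_of_exists_le_of_exists_ge
      (continuous_finsetSum _ fun j _ => continuous_const.mul (hHcont i j)) ?_ ?_
    · have hlim : Tendsto (fun t => ∑ j, K.d i j * H i j t) atTop (𝓝 0) := by
        have := tendsto_finsetSum (Finset.univ : Finset (Fin (N + 1)))
          fun j _ => (hHzero i j).const_mul (K.d i j)
        simpa using this
      exact (hlim.eventually_le_const hs.1).exists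
    · refine ⟨-K.c i i / K.d i i, hs.2.trans ?_⟩
      have h1 : K.m ≤ K.d i i * H i i (-K.c i i / K.d i i) := by
        have : K.c i i + K.d i i * (-K.c i i / K.d i i) + φ i - φ i = 0 := by
          have := (K.d_pos i i).ne'
          field_simp
          ring
        rw [hH]
        simp only [this, max_self]
        exact (lt_mul_totalDemand_zero Q P i i).le
      exact h1.trans (Finset.single_le_sum (f := fun j => K.d i j * H i j (-K.c i i / K.d i i))
        (fun j _ => (mul_pos (K.d_pos i j) (hHpos i j _)).le) (Finset.mem_univ i))
  choose! t ht using hex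
  have hzero : ∀ {s : ℝ}, s ∈ Icc 0 K.m → s ≠ 0 → s ∈ Ioc 0 K.m := fun hs h0 =>
    ⟨hs.1.lt_of_ne' h0, hs.2⟩
  obtain ⟨u, hu, husum, hbal⟩ := exists_balanced_of_monotone (d := K.d) K.m_pos K.d_pos
    (h := fun i j s => if s = 0 then 0 else H i j (t i s)) (by
      intro i j s hs s' hs' hss'
      by_cases h0 : s = 0
      · simp only [h0, if_true]
        split_ifs
        exacts [le_rfl, (hHpos i j _).le]
      have h0' : s' ≠ 0 := fun h => h0 (le_antisymm (h ▸ hss') hs.1)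
      simp only [h0, h0', if_false]
      refine hHanti i j (le_of_not_gt fun hlt => ?_)
      have : s' ≤ s := by
        rw [← ht i s (hzero hs h0), ← ht i s' (hzero hs' h0')]
        exact Finset.sum_le_sum fun j _ =>
          mul_le_mul_of_nonneg_left (hHanti i j hlt.le) (K.d_pos i j).le
      rw [le_antisymm hss' this] at hlt
      exact lt_irrefl _ hlt)
    (by
      intro i j s hs
      split_ifs
      exacts [le_rfl, (hHpos i j _).le])
    (by
      intro i s hs
      by_cases h0 : s = 0
      · simp [h0]
      · simpa only [h0, if_false] using ht i s (hzero hs h0))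
  have hu0 : ∀ i, u i ≠ 0 := by
    obtain ⟨k, hk⟩ : ∃ k, u k ≠ 0 := by
      by_contra! h
      simp only [h, Finset.sum_const_zero] at husum
      exact K.m_pos.ne husum
    intro i hi
    have h1 := hbal i
    simp only [hi, if_true, Finset.sum_const_zero] at h1
    have h2 := (Finset.sum_eq_zero_iff_of_nonneg (fun j _ => by
      split_ifs
      exacts [le_rfl, (hHpos j i _).le])).1 h1.symm k (Finset.mem_univ k)
    simp only [hk, if_false] at h2
    exact (hHpos k i _).ne' h2
  simp only [hu0, if_false] at hbal
  have hsupply : ∑ i, ∑ j, K.d i j * H i j (t i (u i)) = K.m := by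
    rw [← husum]
    exact Finset.sum_congr rfl fun i _ => ht i _ (hzero (hu i) (hu0 i))
  have hpos : ∀ i j, 0 < price K φ (fun i => t i (u i)) i j := by
    intro i j
    have h1 : 0 < max (price K φ (fun i => t i (u i)) i j) 0 := by
      refine pos_of_mul_totalDemand_le Q P (i := i) (j := j) (le_max_right _ _) ?_
      rw [← hsupply]
      calc K.d i j * H i j (t i (u i)) ≤ ∑ j, K.d i j * H i j (t i (u i)) :=
            Finset.single_le_sum (f := fun j => K.d i j * H i j (t i (u i)))
              (fun l _ => (mul_pos (K.d_pos i l) (hHpos i l _)).le) (Finset.mem_univ j)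
        _ ≤ ∑ i, ∑ j, K.d i j * H i j (t i (u i)) :=
            Finset.single_le_sum (f := fun i => ∑ j, K.d i j * H i j (t i (u i)))
              (fun k _ => Finset.sum_nonneg fun l _ => (mul_pos (K.d_pos k l) (hHpos k l _)).le)
              (Finset.mem_univ i)
    rcases lt_max_iff.1 h1 with h | h
    exacts [h, absurd h (lt_irrefl _)]
  have hflow : ∀ i j, H i j (t i (u i)) = driverFlow Q P φ (fun i => t i (u i)) i j := fun i j =>
    congrArg (totalDemand Q P i j) (max_eq_left (hpos i j).le)
  simp only [hflow] at hbal hsupply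
  exact ⟨_, isMarketClearing_iff.2 ⟨hpos, hbal, hsupply⟩⟩

lemma multipliers_isMarketClearing (φ : Fin N → ℝ) :
    IsMarketClearing K Q P (extend φ) (multipliers K Q P φ) := by
  have h := exists_isMarketClearing Q P (extend φ)
  rw [multipliers, dif_pos h]
  exact h.choose_spec

variable {Q P} in
lemma IsMarketClearing.multipliers_eq {φ : Fin N → ℝ} {π : Fin (N + 1) → ℝ}
    (h : IsMarketClearing K Q P (extend φ) π) : multipliers K Q P φ = π :=
  (multipliers_isMarketClearing Q P φ).unique h

lemma outcome_isClearingOutcome (φ : Fin N → ℝ) :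
    IsClearingOutcome K Q P (extend φ) (multipliers K Q P φ) (outcome K Q P φ) := by
  obtain ⟨o, ho⟩ := multipliers_isMarketClearing Q P φ
  have hp : o.p = (outcome K Q P φ).p := funext fun i => funext fun j => ho.price_eq i j
  have hx : o.x = (outcome K Q P φ).x := funext fun i => funext fun j => by
    rw [ho.rider, hp]; rfl
  have hy : o.y = (outcome K Q P φ).y := funext fun i => funext fun j => by
    have h1 := ho.relocation i j
    rw [ho.rider, hp, sub_eq_iff_eq_add, add_comm] at h1
    exact h1
  have : o = outcome K Q P φ := by
    cases o
    simp only at hp hx hy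
    subst hp hx hy
    rfl
  exact this ▸ ho

end

/-! ### Differentiability of the multipliers -/

@[simp] lemma extend_castSucc (φ : Fin N → ℝ) (i : Fin N) : extend φ i.castSucc = φ i := by
  simp [extend]

@[simp] lemma extend_last (φ : Fin N → ℝ) : extend φ (Fin.last N) = 0 := by
  simp [extend]

/-- `extend` as a continuous linear map. -/
noncomputable def extendCLM : (Fin N → ℝ) →L[ℝ] (Fin (N + 1) → ℝ) :=
  LinearMap.toContinuousLinearMap
    { toFun := extend
      map_add' := fun φ ψ => funext fun i => by
        refine Fin.lastCases ?_ (fun i => ?_) i <;> simp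
      map_smul' := fun a φ => funext fun i => by
        refine Fin.lastCases ?_ (fun i => ?_) i <;> simp }

/-- The change of the price of the trip `(i, j)` in response to a change of the adjustments and of
the multipliers. -/
noncomputable def priceCLM (K : MarketCondition N) (i j : Fin (N + 1)) :
    ((Fin N → ℝ) × (Fin (N + 1) → ℝ)) →L[ℝ] ℝ :=
  K.d i j • (ContinuousLinearMap.proj i ∘L ContinuousLinearMap.snd ℝ _ _) +
    (ContinuousLinearMap.proj i ∘L extendCLM ∘L ContinuousLinearMap.fst ℝ _ _) -
    (ContinuousLinearMap.proj j ∘L extendCLM ∘L ContinuousLinearMap.fst ℝ _ _)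

@[simp] lemma priceCLM_apply (i j : Fin (N + 1)) (z : (Fin N → ℝ) × (Fin (N + 1) → ℝ)) :
    priceCLM K i j z = K.d i j * z.2 i + extend z.1 i - extend z.1 j := rfl

lemma price_extend (i j : Fin (N + 1)) (z : (Fin N → ℝ) × (Fin (N + 1) → ℝ)) :
    price K (extend z.1) z.2 i j = priceCLM K i j z + K.c i j := by
  simp only [price, priceCLM_apply]
  ring

lemma price_contDiff (i j : Fin (N + 1)) :
    ContDiff ℝ 1 fun z : (Fin N → ℝ) × (Fin (N + 1) → ℝ) => price K (extend z.1) z.2 i j := by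
  simp only [price_extend]
  exact (priceCLM K i j).contDiff.add contDiff_const

lemma price_hasFDerivAt (i j : Fin (N + 1)) (z : (Fin N → ℝ) × (Fin (N + 1) → ℝ)) :
    HasFDerivAt (fun z : (Fin N → ℝ) × (Fin (N + 1) → ℝ) => price K (extend z.1) z.2 i j)
      (priceCLM K i j) z := by
  simp only [price_extend]
  exact (priceCLM K i j).hasFDerivAt.add_const _

/-- A square system equivalent to the `n` balance equations, which sum to zero, together with the
supply equation: at every location, the net outflow plus the excess `s` of
the drivers used over the supply. -/
lemma balanced_of_residual_eq_zero {ι : Type*} [Fintype ι] [Nonempty ι] {z : ι → ι → ℝ} {s : ℝ}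
    (h : ∀ i, ∑ j, (z i j - z j i) + s = 0) : s = 0 ∧ ∀ i, ∑ j, z i j = ∑ j, z j i := by
  have h1 : ∑ i, ∑ j, (z i j - z j i) = 0 := by
    simp only [Finset.sum_sub_distrib]
    rw [Finset.sum_comm, sub_self]
  have h2 : ∑ i, (∑ j, (z i j - z j i) + s) = 0 := Finset.sum_eq_zero fun i _ => h i
  rw [Finset.sum_add_distrib, h1, zero_add, Finset.sum_const, nsmul_eq_mul] at h2
  have hs : s = 0 := by
    rcases mul_eq_zero.1 h2 with h3 | h3
    · simp at h3
    · exact h3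
  refine ⟨hs, fun i => ?_⟩
  have := h i
  rw [hs, add_zero, Finset.sum_sub_distrib] at this
  linarith

/-- If a change of the multipliers at fixed adjustments keeps the flows balanced and the drivers
used constant to first order, it is zero. -/
lemma eq_zero_of_flow_change {ι : Type*} [Fintype ι] {d g : ι → ι → ℝ} {w : ι → ℝ}
    (hd : ∀ i j, 0 < d i j) (hg : ∀ i j, g i j < 0)
    (hz : ∀ i, ∑ j, g i j * (d i j * w i) = ∑ j, g j i * (d j i * w j))
    (hs : ∑ i, ∑ j, d i j * (g i j * (d i j * w i)) = 0) : w = 0 := by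
  funext i
  refine le_antisymm ?_ ?_
  · exact nonpos_of_balanced_of_supply (θ := w) hd hz hs
      (fun i hi j => mul_neg_of_neg_of_pos (hg i j) (mul_pos (hd i j) hi))
      (fun i hi j => mul_nonneg_of_nonpos_of_nonpos (hg i j).le
        (mul_nonpos_of_nonneg_of_nonpos (hd i j).le hi)) i
  · refine neg_nonpos.1 (nonpos_of_balanced_of_supply (θ := fun i => -w i)
      (z := fun i j => -(g i j * (d i j * w i))) hd (fun i => ?_) ?_ (fun i hi j => ?_)
      (fun i hi j => ?_) i)
    · simp only [Finset.sum_neg_distrib, hz]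
    · simp only [mul_neg, Finset.sum_neg_distrib, hs, neg_zero]
    · exact neg_neg_of_pos (mul_pos_of_neg_of_neg (hg i j)
        (mul_neg_of_pos_of_neg (hd i j) (neg_pos.1 hi)))
    · exact neg_nonneg.2 (mul_nonpos_of_nonpos_of_nonneg (hg i j).le
        (mul_nonneg (hd i j).le (neg_nonpos.1 hi)))

section

variable (Q : RiderDemand N) (P : PhantomDemand K)

/-- The map whose zeros with positive prices are the market-clearing pairs `(φ, π)`: at each
location, the net outflow of drivers plus the excess of the drivers used over the supply. -/
noncomputable def clearingMap (z : (Fin N → ℝ) × (Fin (N + 1) → ℝ)) : Fin (N + 1) → ℝ := fun i =>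
  ∑ j, (driverFlow Q P (extend z.1) z.2 i j - driverFlow Q P (extend z.1) z.2 j i) +
    (∑ k, ∑ l, K.d k l * driverFlow Q P (extend z.1) z.2 k l - K.m)

/-- The change of the driver flow of the trip `(i, j)` in response to a change of the adjustments
and of the multipliers. -/
noncomputable def flowCLM (z : (Fin N → ℝ) × (Fin (N + 1) → ℝ)) (i j : Fin (N + 1)) :
    ((Fin N → ℝ) × (Fin (N + 1) → ℝ)) →L[ℝ] ℝ :=
  demandSlope Q P i j (price K (extend z.1) z.2 i j) • priceCLM K i j

/-- The derivative of `clearingMap`. -/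
noncomputable def clearingCLM (z : (Fin N → ℝ) × (Fin (N + 1) → ℝ)) :
    ((Fin N → ℝ) × (Fin (N + 1) → ℝ)) →L[ℝ] (Fin (N + 1) → ℝ) :=
  ContinuousLinearMap.pi fun i => ∑ j, (flowCLM Q P z i j - flowCLM Q P z j i) +
    ∑ k, ∑ l, K.d k l • flowCLM Q P z k l

variable {Q P}

lemma isMarketClearing_of_clearingMap_eq_zero {z : (Fin N → ℝ) × (Fin (N + 1) → ℝ)}
    (hp : ∀ i j, 0 < price K (extend z.1) z.2 i j) (h : clearingMap Q P z = 0) :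
    IsMarketClearing K Q P (extend z.1) z.2 := by
  obtain ⟨h1, h2⟩ := balanced_of_residual_eq_zero fun i => congrFun h i
  exact isMarketClearing_iff.2 ⟨hp, h2, sub_eq_zero.1 h1⟩

lemma clearingMap_eq_zero {φ : Fin N → ℝ} {π : Fin (N + 1) → ℝ}
    (h : IsMarketClearing K Q P (extend φ) π) : clearingMap Q P (φ, π) = 0 := by
  funext i
  simp only [clearingMap, h.supply, Finset.sum_sub_distrib, h.balance, sub_self, add_zero,
    Pi.zero_apply]

lemma driverFlow_contDiffAt {z : (Fin N → ℝ) × (Fin (N + 1) → ℝ)} {i j : Fin (N + 1)}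
    (hp : 0 < price K (extend z.1) z.2 i j) :
    ContDiffAt ℝ 1 (fun z : (Fin N → ℝ) × (Fin (N + 1) → ℝ) =>
      driverFlow Q P (extend z.1) z.2 i j) z :=
  ContDiffAt.comp (f := fun z : (Fin N → ℝ) × (Fin (N + 1) → ℝ) => price K (extend z.1) z.2 i j) z
    (totalDemand_contDiffAt Q P i j hp) (price_contDiff i j).contDiffAt

lemma driverFlow_hasFDerivAt {z : (Fin N → ℝ) × (Fin (N + 1) → ℝ)} {i j : Fin (N + 1)}
    (hp : 0 < price K (extend z.1) z.2 i j) :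
    HasFDerivAt (fun z : (Fin N → ℝ) × (Fin (N + 1) → ℝ) => driverFlow Q P (extend z.1) z.2 i j)
      (flowCLM Q P z i j) z :=
  HasDerivAt.comp_hasFDerivAt z (totalDemand_hasDerivAt Q P i j hp) (price_hasFDerivAt i j z)

lemma clearingMap_contDiffAt {z : (Fin N → ℝ) × (Fin (N + 1) → ℝ)}
    (hp : ∀ i j, 0 < price K (extend z.1) z.2 i j) : ContDiffAt ℝ 1 (clearingMap Q P) z := by
  refine contDiffAt_pi.2 fun i => ContDiffAt.add (ContDiffAt.sum fun j _ => ?_)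
    (ContDiffAt.sub (ContDiffAt.sum fun k _ => ContDiffAt.sum fun l _ => ?_) contDiffAt_const)
  · exact (driverFlow_contDiffAt (hp i j)).sub (driverFlow_contDiffAt (hp j i))
  · exact contDiffAt_const.mul (driverFlow_contDiffAt (hp k l))

lemma clearingMap_hasFDerivAt {z : (Fin N → ℝ) × (Fin (N + 1) → ℝ)}
    (hp : ∀ i j, 0 < price K (extend z.1) z.2 i j) :
    HasFDerivAt (clearingMap Q P) (clearingCLM Q P z) z := by
  refine hasFDerivAt_pi.2 fun i => HasFDerivAt.add (HasFDerivAt.fun_sum fun j _ => ?_)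
    (HasFDerivAt.sub_const _ (HasFDerivAt.fun_sum fun k _ => HasFDerivAt.fun_sum fun l _ => ?_))
  · exact (driverFlow_hasFDerivAt (hp i j)).sub (driverFlow_hasFDerivAt (hp j i))
  · exact (driverFlow_hasFDerivAt (hp k l)).const_mul _

/-- Changes annihilated by the derivative of `clearingMap` keep the flows balanced and the drivers
used constant to first order. -/
lemma flow_change_of_clearingCLM_eq_zero {z v : (Fin N → ℝ) × (Fin (N + 1) → ℝ)}
    (h : clearingCLM Q P z v = 0) :
    ∑ i, ∑ j, K.d i j * flowCLM Q P z i j v = 0 ∧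
      ∀ i, ∑ j, flowCLM Q P z i j v = ∑ j, flowCLM Q P z j i v := by
  refine balanced_of_residual_eq_zero fun i => ?_
  have := congrFun h i
  simpa [clearingCLM] using this

lemma flowCLM_apply (z v : (Fin N → ℝ) × (Fin (N + 1) → ℝ)) (i j : Fin (N + 1)) :
    flowCLM Q P z i j v = demandSlope Q P i j (price K (extend z.1) z.2 i j) *
      (K.d i j * v.2 i + extend v.1 i - extend v.1 j) := rfl

/-- The partial derivative of `clearingMap` in the multipliers is injective. -/
lemma eq_zero_of_clearingCLM_eq_zero {z : (Fin N → ℝ) × (Fin (N + 1) → ℝ)}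
    (hp : ∀ i j, 0 < price K (extend z.1) z.2 i j) {w : Fin (N + 1) → ℝ}
    (h : clearingCLM Q P z (0, w) = 0) : w = 0 := by
  obtain ⟨h1, h2⟩ := flow_change_of_clearingCLM_eq_zero h
  have h0 : ∀ i : Fin (N + 1), extend (0 : Fin N → ℝ) i = 0 := fun i => by
    refine Fin.lastCases ?_ (fun i => ?_) i <;> simp
  simp only [flowCLM_apply, h0, add_zero, sub_zero] at h1 h2
  exact eq_zero_of_flow_change K.d_pos (fun i j => demandSlope_neg Q P i j (hp i j).le) h2 h1

variable (Q P)

lemma price_multipliers_pos (φ : Fin N → ℝ) (i j : Fin (N + 1)) :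
    0 < price K (extend φ) (multipliers K Q P φ) i j :=
  (multipliers_isMarketClearing Q P φ).price_pos i j

/-- The implicit function given by `clearingMap` agrees with the market-clearing multipliers, by
the uniqueness of the latter. -/
lemma multipliers_contDiff : ContDiff ℝ 1 (multipliers K Q P) := by
  refine contDiff_iff_contDiffAt.2 fun φ => ?_
  set u : (Fin N → ℝ) × (Fin (N + 1) → ℝ) := (φ, multipliers K Q P φ) with hu
  have hp : ∀ i j, 0 < price K (extend u.1) u.2 i j := price_multipliers_pos Q P φ
  have hcd : ContDiffAt ℝ 1 (clearingMap Q P) u := clearingMap_contDiffAt hp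
  have hinv : (fderiv ℝ (clearingMap Q P) u ∘L
      ContinuousLinearMap.inr ℝ (Fin N → ℝ) (Fin (N + 1) → ℝ)).IsInvertible := by
    rw [(clearingMap_hasFDerivAt hp).fderiv]
    set B := clearingCLM Q P u ∘L ContinuousLinearMap.inr ℝ (Fin N → ℝ) (Fin (N + 1) → ℝ) with hB
    have hinj : Function.Injective (B : (Fin (N + 1) → ℝ) →ₗ[ℝ] (Fin (N + 1) → ℝ)) :=
      (injective_iff_map_eq_zero _).2 fun w hw => eq_zero_of_clearingCLM_eq_zero hp hw
    refine ⟨(LinearEquiv.ofInjectiveEndo _ hinj).toContinuousLinearEquiv, ?_⟩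
    ext w
    rfl
  have hψ := hcd.contDiffAt_implicitFunction one_ne_zero hinv
  refine hψ.congr_of_eventuallyEq ?_
  have hcont : Tendsto (fun x => (x, hcd.implicitFunction one_ne_zero hinv x)) (𝓝 φ) (𝓝 u) := by
    have h1 : hcd.implicitFunction one_ne_zero hinv φ = u.2 :=
      hcd.implicitFunction_apply_self one_ne_zero hinv
    have h2 : ContinuousAt (hcd.implicitFunction one_ne_zero hinv) φ := hψ.continuousAt
    have h3 : Tendsto (fun x => (x, hcd.implicitFunction one_ne_zero hinv x)) (𝓝 φ)
        (𝓝 (φ, hcd.implicitFunction one_ne_zero hinv φ)) :=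
      (continuousAt_id.prodMk h2)
    rwa [h1] at h3
  have hpos : ∀ᶠ z in 𝓝 u, ∀ i j, 0 < price K (extend z.1) z.2 i j :=
    eventually_all.2 fun i => eventually_all.2 fun j =>
      (price_contDiff i j).continuous.continuousAt.eventually (lt_mem_nhds (hp i j))
  filter_upwards [hcd.eventually_apply_implicitFunction one_ne_zero hinv, hcont.eventually hpos]
    with x hx hxp
  refine IsMarketClearing.multipliers_eq (isMarketClearing_of_clearingMap_eq_zero
    (z := (x, hcd.implicitFunction one_ne_zero hinv x)) hxp ?_)
  rw [hx]
  exact clearingMap_eq_zero (multipliers_isMarketClearing Q P φ)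

lemma multipliers_hasFDerivAt (φ : Fin N → ℝ) :
    HasFDerivAt (multipliers K Q P) (fderiv ℝ (multipliers K Q P) φ) φ :=
  ((multipliers_contDiff Q P).differentiable one_ne_zero φ).hasFDerivAt

/-- The linear system satisfied by the derivative of the multipliers. -/
lemma clearingCLM_fderiv_multipliers (φ v : Fin N → ℝ) :
    clearingCLM Q P (φ, multipliers K Q P φ) (v, fderiv ℝ (multipliers K Q P) φ v) = 0 := by
  have h1 : HasFDerivAt (fun x => clearingMap Q P (x, multipliers K Q P x))
      ((clearingCLM Q P (φ, multipliers K Q P φ)) ∘L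
        ((ContinuousLinearMap.id ℝ (Fin N → ℝ)).prod (fderiv ℝ (multipliers K Q P) φ))) φ :=
    HasFDerivAt.comp φ (clearingMap_hasFDerivAt (price_multipliers_pos Q P φ))
      ((hasFDerivAt_id φ).prodMk (multipliers_hasFDerivAt Q P φ))
  have h2 : (fun x => clearingMap Q P (x, multipliers K Q P x)) = fun _ => 0 :=
    funext fun x => clearingMap_eq_zero (multipliers_isMarketClearing Q P x)
  rw [h2] at h1
  exact congrArg (fun A : (Fin N → ℝ) →L[ℝ] (Fin (N + 1) → ℝ) => A v)
    (h1.unique (hasFDerivAt_const 0 φ))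

end

/-! ### The Newton direction -/

section

variable (Q : RiderDemand N) (P : PhantomDemand K)

lemma newtonMatrix_mulVec (φ : Fin N → ℝ) (z : Fin (N + 1) → ℝ) (i : Fin (N + 1)) :
    (newtonMatrix K Q P φ).mulVec z i =
      -fderiv ℝ (multipliers K Q P) φ (fun j => z j.castSucc) i + z (Fin.last N) := by
  set D := fderiv ℝ (multipliers K Q P) φ
  have h1 : D (fun j => z j.castSucc) = ∑ j, z j.castSucc • D (Pi.single j 1) := by
    conv_lhs => rw [pi_eq_sum_univ' fun j : Fin N => z j.castSucc]
    simp only [map_sum, map_smul]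
  rw [h1, Matrix.mulVec, dotProduct, Fin.sum_univ_castSucc]
  simp [newtonMatrix, D, mul_comm]

/-- A change of adjustments that changes all multipliers equally is zero: the induced price changes
`dp` and flow changes `dy` satisfy `∑ dy * dp = 0`, as `dy` is balanced and uses no drivers. -/
lemma eq_zero_of_fderiv_multipliers_eq_const {φ v : Fin N → ℝ} {w : ℝ}
    (h : ∀ i, fderiv ℝ (multipliers K Q P) φ v i = w) : v = 0 ∧ w = 0 := by
  obtain ⟨h1, h2⟩ := flow_change_of_clearingCLM_eq_zero (clearingCLM_fderiv_multipliers Q P φ v)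
  set z : (Fin N → ℝ) × (Fin (N + 1) → ℝ) := (φ, multipliers K Q P φ) with hz
  set y := fun i j => flowCLM Q P z i j (v, fderiv ℝ (multipliers K Q P) φ v) with hy
  set p := fun i j => K.d i j * w + extend v i - extend v j with hp
  have hyp : ∀ i j, y i j = demandSlope Q P i j (price K (extend z.1) z.2 i j) * p i j :=
    fun i j => by simp only [hy, flowCLM_apply, h, hp]
  have hneg : ∀ i j, demandSlope Q P i j (price K (extend z.1) z.2 i j) < 0 := fun i j =>
    demandSlope_neg Q P i j (price_multipliers_pos Q P φ i j).le
  have hsum : ∑ i, ∑ j, -(y i j * p i j) = 0 := by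
    have h3 : ∀ i j, -(y i j * p i j) =
        -w * (K.d i j * y i j) - (extend v i - extend v j) * y i j := fun i j => by
      simp only [hp]; ring
    simp only [h3, Finset.sum_sub_distrib, ← Finset.mul_sum]
    have h4 := sum_potential_mul_of_balanced h2 (extend v)
    rw [h1, h4, mul_zero, sub_zero]
  have hnn : ∀ i j, 0 ≤ -(y i j * p i j) := fun i j => by
    rw [hyp]
    have := mul_nonneg (neg_nonneg.2 (hneg i j).le) (mul_self_nonneg (p i j))
    linarith
  have hp0 : ∀ i j, p i j = 0 := fun i j => by
    have h5 := (Finset.sum_eq_zero_iff_of_nonneg fun i _ => Finset.sum_nonneg fun j _ =>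
      hnn i j).1 hsum i (Finset.mem_univ i)
    have h6 := (Finset.sum_eq_zero_iff_of_nonneg fun j _ => hnn i j).1 h5 j (Finset.mem_univ j)
    rw [hyp] at h6
    by_contra hne
    refine mul_ne_zero (mul_ne_zero (hneg i j).ne hne) hne ?_
    linarith
  have hw : w = 0 := by
    have := hp0 0 0
    simp only [hp, add_sub_cancel_right, mul_eq_zero, (K.d_pos 0 0).ne', false_or] at this
    exact this
  refine ⟨funext fun i => ?_, hw⟩
  have := hp0 i.castSucc (Fin.last N)
  simpa [hp, hw] using this

lemma newtonMatrix_isUnit_det (φ : Fin N → ℝ) : IsUnit (newtonMatrix K Q P φ).det := by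
  rw [← Matrix.isUnit_iff_isUnit_det, ← Matrix.mulVec_injective_iff_isUnit]
  refine (injective_iff_map_eq_zero (newtonMatrix K Q P φ).mulVecLin).2 fun z hz => ?_
  have h1 : ∀ i, fderiv ℝ (multipliers K Q P) φ (fun j => z j.castSucc) i = z (Fin.last N) := by
    intro i
    have := congrFun hz i
    rw [Matrix.mulVecLin_apply, newtonMatrix_mulVec, Pi.zero_apply] at this
    linarith
  obtain ⟨h2, h3⟩ := eq_zero_of_fderiv_multipliers_eq_const Q P h1
  funext i
  refine Fin.lastCases h3 (fun i => congrFun h2 i) i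

/-- To first order, the Newton direction makes all multipliers equal. -/
lemma exists_fderiv_multipliers_direction (φ : Fin N → ℝ) :
    ∃ w : ℝ, ∀ i, multipliers K Q P φ i +
      fderiv ℝ (multipliers K Q P) φ (direction K Q P φ) i = w := by
  set z := (newtonMatrix K Q P φ)⁻¹.mulVec (multipliers K Q P φ) with hz
  have h1 : (newtonMatrix K Q P φ).mulVec z = multipliers K Q P φ := by
    rw [hz, Matrix.mulVec_mulVec, Matrix.mul_nonsing_inv _ (newtonMatrix_isUnit_det Q P φ),
      Matrix.one_mulVec]
  refine ⟨z (Fin.last N), fun i => ?_⟩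
  have h2 := congrFun h1 i
  rw [newtonMatrix_mulVec] at h2
  have h3 : direction K Q P φ = fun j => z j.castSucc := rfl
  rw [h3]
  linarith

lemma direction_eq_zero {φ : Fin N → ℝ} {w : ℝ} (h : ∀ i, multipliers K Q P φ i = w) :
    direction K Q P φ = 0 := by
  obtain ⟨w', hw'⟩ := exists_fderiv_multipliers_direction Q P φ
  refine (eq_zero_of_fderiv_multipliers_eq_const Q P (φ := φ) (w := w' - w) fun i => ?_).1
  rw [← hw' i, h i]
  ring

lemma fderiv_multipliers_continuous : Continuous (fderiv ℝ (multipliers K Q P)) :=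
  (multipliers_contDiff Q P).continuous_fderiv one_ne_zero

lemma direction_continuous : Continuous (direction K Q P) := by
  have h1 : Continuous (newtonMatrix K Q P) := by
    refine continuous_matrix fun i j => ?_
    refine Fin.lastCases ?_ (fun j => ?_) j
    · simpa [newtonMatrix] using continuous_const
    · simp only [newtonMatrix, Matrix.of_apply, Fin.snoc_castSucc]
      exact ((continuous_apply i).comp
        ((fderiv_multipliers_continuous Q P).clm_apply continuous_const)).neg
  have h2 : Continuous fun φ => (newtonMatrix K Q P φ)⁻¹ := by
    simp only [Matrix.inv_def, Ring.inverse_eq_inv']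
    exact (h1.matrix_det.inv₀ fun φ => (newtonMatrix_isUnit_det Q P φ).ne_zero).smul
      h1.matrix_adjugate
  exact continuous_pi fun j => (continuous_apply _).comp
    (h2.matrix_mulVec (multipliers_contDiff Q P).continuous)

end

/-! ### Convergence of backtracking line search -/

/-- Near a point that is not a zero of `f`, the sufficient decrease condition holds for all small
stepsizes, uniformly in the base point. -/
lemma exists_uniform_stepsize {E : Type*} [NormedAddCommGroup E] [NormedSpace ℝ E] {f : E → ℝ}
    {δ : E → E} {σ : ℝ} (hf : ContDiff ℝ 1 f) (hδ : Continuous δ)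
    (hdesc : ∀ x, fderiv ℝ f x (δ x) = -2 * f x) (hσ : σ < 1) {b : E} (hb : 0 < f b) :
    ∃ a : ℝ, 0 < a ∧ ∀ᶠ x in 𝓝 b, ∀ α : ℝ, 0 < α → α ≤ a →
      f (x + α • δ x) < f x + σ * fderiv ℝ f x (α • δ x) := by
  -- the error of the linearization stays below the slack `(1 - σ) * f b` of the condition at `b`
  set ε : ℝ := (1 - σ) * f b / (‖δ b‖ + 1) with hε
  have hnorm : 0 < ‖δ b‖ + 1 := by positivity
  have hεpos : 0 < ε := div_pos (mul_pos (sub_pos.2 hσ) hb) hnorm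
  have hstrict : ∀ᶠ p : E × E in 𝓝 (b, b),
      ‖f p.1 - f p.2 - fderiv ℝ f b (p.1 - p.2)‖ ≤ ε * ‖p.1 - p.2‖ :=
    (hf.contDiffAt.hasStrictFDerivAt one_ne_zero).isLittleO.def hεpos
  have hmap : Tendsto (fun p : E × ℝ => (p.1 + p.2 • δ p.1, p.1)) (𝓝 (b, 0)) (𝓝 (b, b)) := by
    have h1 : Continuous fun p : E × ℝ => (p.1 + p.2 • δ p.1, p.1) := by fun_prop
    simpa using h1.tendsto (b, (0 : ℝ))
  have hev := hmap.eventually hstrict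
  rw [nhds_prod_eq, eventually_prod_iff] at hev
  obtain ⟨pa, hpa, pb, hpb, hall⟩ := hev
  obtain ⟨r, hr, hball⟩ := Metric.eventually_nhds_iff.1 hpb
  have hneg : ∀ᶠ x in 𝓝 b, fderiv ℝ f b (δ x) + ε * ‖δ x‖ + 2 * σ * f x < 0 := by
    have hc : Continuous fun x => fderiv ℝ f b (δ x) + ε * ‖δ x‖ + 2 * σ * f x :=
      (((fderiv ℝ f b).continuous.comp hδ).add (continuous_const.mul hδ.norm)).add
        (continuous_const.mul hf.continuous)
    refine hc.continuousAt.eventually (gt_mem_nhds ?_)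
    have h1 : ε * (‖δ b‖ + 1) = (1 - σ) * f b := div_mul_cancel₀ _ hnorm.ne'
    have h2 : 0 < (1 - σ) * f b := mul_pos (sub_pos.2 hσ) hb
    dsimp only
    rw [hdesc]
    linarith
  refine ⟨r / 2, half_pos hr, ?_⟩
  filter_upwards [hpa, hneg] with x hx hxneg α hα hαr
  have h1 := hall hx (hball (y := α) (by rw [Real.dist_eq, sub_zero, abs_of_pos hα]; linarith))
  simp only [add_sub_cancel_left, map_smul, norm_smul, Real.norm_eq_abs, abs_of_pos hα,
    smul_eq_mul] at h1
  have h2 := (abs_le.1 h1).2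
  have h3 := mul_neg_of_pos_of_neg hα hxneg
  rw [map_smul, smul_eq_mul, hdesc]
  linarith

/-- Global convergence of backtracking line search along a continuous direction field `δ` with
`∇f · δ = -2 f`. Near a cluster point `b` of the base points with `f b ≠ 0`, the accepted stepsizes
are bounded below, so each visit decreases `f` by a fixed amount; hence all cluster points are
zeros of `f`. -/
lemma tendsto_of_backtracking {E : Type*} [NormedAddCommGroup E] [NormedSpace ℝ E] {f : E → ℝ}
    {δ : E → E} {s : E → ℝ} {β σ : ℝ} (hf : ContDiff ℝ 1 f) (hf0 : ∀ x, 0 ≤ f x)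
    (hcompact : ∀ C, IsCompact {x | f x ≤ C}) (hδ : Continuous δ)
    (hdesc : ∀ x, fderiv ℝ f x (δ x) = -2 * f x) (hzero : ∀ x, f x = 0 → δ x = 0)
    (huniq : ∀ x y, f x = 0 → f y = 0 → x = y) (hs : Continuous s) (hspos : ∀ x, 0 < s x)
    (hsle : ∀ x, s x ≤ 1) (hβ : β ∈ Ioo (0 : ℝ) 1) (hσ : σ ∈ Ioo (0 : ℝ) 1) {base : ℕ → E}
    {step : ℕ → ℝ} (hstep0 : step 0 = s (base 0))
    (haccept : ∀ t, f (base t + step t • δ (base t)) <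
        f (base t) + σ * fderiv ℝ f (base t) (step t • δ (base t)) →
      base (t + 1) = base t + step t • δ (base t) ∧ step (t + 1) = s (base (t + 1)))
    (hreject : ∀ t, ¬ f (base t + step t • δ (base t)) <
        f (base t) + σ * fderiv ℝ f (base t) (step t • δ (base t)) →
      base (t + 1) = base t ∧ step (t + 1) = β * step t) :
    ∃ x, f x = 0 ∧ Tendsto (fun t => base t + step t • δ (base t)) atTop (𝓝 x) := by
  set A : ℕ → Prop := fun t => f (base t + step t • δ (base t)) <
    f (base t) + σ * fderiv ℝ f (base t) (step t • δ (base t)) with hA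
  have hstep : ∀ t, 0 < step t ∧ step t ≤ 1 := by
    intro t
    induction t with
    | zero => rw [hstep0]; exact ⟨hspos _, hsle _⟩
    | succ t ih =>
      by_cases h : A t
      · rw [(haccept t h).2]
        exact ⟨hspos _, hsle _⟩
      · rw [(hreject t h).2]
        exact ⟨mul_pos hβ.1 ih.1, mul_le_one₀ hβ.2.le ih.1.le ih.2⟩
  have hdecr : ∀ t, A t → f (base (t + 1)) < f (base t) - 2 * σ * step t * f (base t) := by
    intro t h
    rw [(haccept t h).1]
    have h1 : f (base t + step t • δ (base t)) <
      f (base t) + σ * fderiv ℝ f (base t) (step t • δ (base t)) := h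
    rw [map_smul, smul_eq_mul, hdesc] at h1
    linarith
  have hanti : Antitone fun t => f (base t) := by
    refine antitone_nat_of_succ_le fun t => ?_
    by_cases h : A t
    · have h1 := hdecr t h
      have h2 := mul_nonneg (mul_nonneg hσ.1.le (hstep t).1.le) (hf0 (base t))
      linarith
    · rw [(hreject t h).1]
  have hbdd : BddBelow (range fun t => f (base t)) := ⟨0, by rintro _ ⟨t, rfl⟩; exact hf0 _⟩
  have hcluster : ∀ b, MapClusterPt b atTop base → f b = 0 := by
    intro b hclus
    by_contra hne
    have hb : 0 < f b := (hf0 b).lt_of_ne' hne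
    obtain ⟨a, ha, hev⟩ := exists_uniform_stepsize hf hδ hdesc hσ.2 hb
    set α : ℝ := min (β * a) (s b / 2) with hα
    have hαpos : 0 < α := lt_min (mul_pos hβ.1 ha) (half_pos (hspos b))
    have hU : ∀ᶠ x in 𝓝 b, (∀ α : ℝ, 0 < α → α ≤ a →
        f (x + α • δ x) < f x + σ * fderiv ℝ f x (α • δ x)) ∧ s b / 2 < s x ∧ f b / 2 < f x :=
      hev.and ((hs.continuousAt.eventually (lt_mem_nhds (half_lt_self (hspos b)))).and
        (hf.continuous.continuousAt.eventually (lt_mem_nhds (half_lt_self hb))))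
    set U : E → Prop := fun x => (∀ α : ℝ, 0 < α → α ≤ a →
        f (x + α • δ x) < f x + σ * fderiv ℝ f x (α • δ x)) ∧ s b / 2 < s x ∧ f b / 2 < f x
    have hlow : ∀ t, U (base t) → α ≤ step t := by
      intro t
      induction t with
      | zero =>
        intro h
        rw [hstep0]
        exact (min_le_right _ _).trans h.2.1.le
      | succ t ih =>
        intro h
        by_cases hacc : A t
        · rw [(haccept t hacc).2]
          exact (min_le_right _ _).trans h.2.1.le
        · rw [(hreject t hacc).2]
          rw [(hreject t hacc).1] at h
          have : a < step t := not_le.1 fun hle => hacc (h.1 _ (hstep t).1 hle)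
          exact (min_le_left _ _).trans (mul_le_mul_of_nonneg_left this.le hβ.1.le)
    have hfind : ∀ t, U (base t) → ∃ k, A (t + k) ∧ base (t + k) = base t := by
      intro t ht
      by_contra! hno
      have hk : ∀ k, base (t + k) = base t ∧ step (t + k) = β ^ k * step t := by
        intro k
        induction k with
        | zero => simp
        | succ k ih =>
          have h1 := hreject (t + k) fun h => hno k h ih.1
          refine ⟨h1.1.trans ih.1, h1.2.trans ?_⟩
          rw [ih.2]
          ring
      have hlim : Tendsto (fun k => β ^ k * step t) atTop (𝓝 0) := by
        simpa using (tendsto_pow_atTop_nhds_zero_of_lt_one hβ.1.le hβ.2).mul_const (step t)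
      obtain ⟨k, hk'⟩ := (hlim.eventually (gt_mem_nhds hαpos)).exists
      rw [← (hk k).2] at hk'
      exact (hlow (t + k) ((hk k).1.symm ▸ ht)).not_gt hk'
    -- once `f` is within `σ * α * f b` of its infimum, no further visit is possible
    have hc : 0 < σ * α * f b := mul_pos (mul_pos hσ.1 hαpos) hb
    obtain ⟨T, hT⟩ := exists_lt_of_ciInf_lt (lt_add_of_pos_right (⨅ t, f (base t)) hc)
    obtain ⟨t, htU, hTt⟩ := ((hclus.frequently hU).and_eventually (eventually_ge_atTop T)).exists
    obtain ⟨k, hAk, hk⟩ := hfind t htU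
    have hUk : U (base (t + k)) := hk.symm ▸ htU
    have h1 := hdecr _ hAk
    have h2 : f (base (t + k)) ≤ f (base T) := hanti (hTt.trans (Nat.le_add_right t k))
    have h3 : (⨅ t, f (base t)) ≤ f (base (t + k + 1)) := ciInf_le hbdd (t + k + 1)
    have h4 : α * (f b / 2) ≤ step (t + k) * f (base (t + k)) :=
      mul_le_mul (hlow _ hUk) hUk.2.2.le (half_pos hb).le (hstep _).1.le
    have h5 := mul_le_mul_of_nonneg_left h4 hσ.1.le
    linarith
  have hmem : ∀ t, base t ∈ {x | f x ≤ f (base 0)} := fun t => hanti (Nat.zero_le t)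
  obtain ⟨x, -, hx⟩ := (hcompact (f (base 0))).exists_mapClusterPt_of_frequently (l := atTop) (f := base)
    (Frequently.of_forall hmem)
  have hx0 := hcluster x hx
  have hbase : Tendsto base atTop (𝓝 x) :=
    (hcompact (f (base 0))).tendsto_nhds_of_unique_mapClusterPt (Eventually.of_forall hmem)
      fun y _ hy => huniq y x (hcluster y hy) hx0
  refine ⟨x, hx0, ?_⟩
  have hδ0 : Tendsto (fun t => ‖δ (base t)‖) atTop (𝓝 0) := by
    have h1 := ((hδ.tendsto x).comp hbase).norm
    rwa [hzero x hx0, norm_zero] at h1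
  have hsmul : Tendsto (fun t => step t • δ (base t)) atTop (𝓝 0) := by
    refine squeeze_zero_norm (fun t => ?_) hδ0
    rw [norm_smul, Real.norm_of_nonneg (hstep t).1.le]
    exact mul_le_of_le_one_left (norm_nonneg _) (hstep t).2
  simpa using hbase.add hsmul

/-! ### The Lyapunov function -/

section

variable (Q : RiderDemand N) (P : PhantomDemand K)

lemma lyapunov_nonneg (φ : Fin N → ℝ) : 0 ≤ lyapunov K Q P φ :=
  Finset.sum_nonneg fun _ _ => sq_nonneg _

lemma lyapunov_contDiff : ContDiff ℝ 1 (lyapunov K Q P) := by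
  have h := contDiff_pi.1 (multipliers_contDiff Q P)
  exact ContDiff.sum fun i _ => ((h i).sub (contDiff_const.mul (ContDiff.sum fun j _ => h j))).pow 2

lemma fderiv_lyapunov (φ v : Fin N → ℝ) : fderiv ℝ (lyapunov K Q P) φ v =
    ∑ i, 2 * (multipliers K Q P φ i - 1 / ((N : ℝ) + 1) * ∑ j, multipliers K Q P φ j) *
      (fderiv ℝ (multipliers K Q P) φ v i -
        1 / ((N : ℝ) + 1) * ∑ j, fderiv ℝ (multipliers K Q P) φ v j) := by
  have h := hasFDerivAt_pi'.1 (multipliers_hasFDerivAt Q P φ)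
  set D := fderiv ℝ (multipliers K Q P) φ
  let D' : Fin (N + 1) → (Fin N → ℝ) →L[ℝ] ℝ := fun j => ContinuousLinearMap.proj j ∘L D
  have havg : HasFDerivAt (fun x => 1 / ((N : ℝ) + 1) * ∑ j, multipliers K Q P x j)
      ((1 / ((N : ℝ) + 1)) • ∑ j, D' j) φ :=
    (HasFDerivAt.fun_sum fun j _ => h j).const_mul _
  have hf : HasFDerivAt (lyapunov K Q P) (∑ i, (2 * (multipliers K Q P φ i -
      1 / ((N : ℝ) + 1) * ∑ j, multipliers K Q P φ j)) • (D' i -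
        (1 / ((N : ℝ) + 1)) • ∑ j, D' j)) φ :=
    HasFDerivAt.fun_sum fun i _ => by simpa using ((h i).sub havg).pow 2
  rw [hf.fderiv]
  simp [D']

lemma fderiv_lyapunov_direction (φ : Fin N → ℝ) :
    fderiv ℝ (lyapunov K Q P) φ (direction K Q P φ) = -2 * lyapunov K Q P φ := by
  obtain ⟨w, hw⟩ := exists_fderiv_multipliers_direction Q P φ
  have h1 : ∀ i, fderiv ℝ (multipliers K Q P) φ (direction K Q P φ) i =
      w - multipliers K Q P φ i := fun i => by rw [← hw i]; ring
  have h2 : 1 / ((N : ℝ) + 1) * ∑ _j : Fin (N + 1), w = w := by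
    have : (N : ℝ) + 1 ≠ 0 := by positivity
    simp only [Finset.sum_const, Finset.card_univ, Fintype.card_fin, nsmul_eq_mul]
    push_cast
    field_simp
  rw [fderiv_lyapunov, lyapunov, Finset.mul_sum Finset.univ _ (-2)]
  refine Finset.sum_congr rfl fun i _ => ?_
  simp only [h1, Finset.sum_sub_distrib]
  rw [mul_sub (1 / ((N : ℝ) + 1)), h2]
  ring

lemma multipliers_eq_of_lyapunov_eq_zero {φ : Fin N → ℝ} (h : lyapunov K Q P φ = 0)
    (i : Fin (N + 1)) :
    multipliers K Q P φ i = 1 / ((N : ℝ) + 1) * ∑ j, multipliers K Q P φ j :=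
  sub_eq_zero.1 (pow_eq_zero_iff two_ne_zero |>.1
    ((Finset.sum_eq_zero_iff_of_nonneg fun _ _ => sq_nonneg _).1 h i (Finset.mem_univ i)))

variable {Q P} in
/-- Adjustments that equalize the multipliers are unique: for two such, the flow differences `Δy`
and the price differences `Δp` satisfy `∑ Δy * Δp = 0`. -/
lemma eq_of_isMarketClearing_const {φ φ' : Fin N → ℝ} {w w' : ℝ}
    (h : IsMarketClearing K Q P (extend φ) fun _ => w)
    (h' : IsMarketClearing K Q P (extend φ') fun _ => w') : φ = φ' := by
  set p := price K (extend φ) fun _ => w with hp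
  set p' := price K (extend φ') fun _ => w' with hp'
  set y := driverFlow Q P (extend φ) fun _ => w with hy
  set y' := driverFlow Q P (extend φ') fun _ => w' with hy'
  have hdiff : ∀ i j, p i j - p' i j = K.d i j * (w - w') +
      ((extend φ i - extend φ' i) - (extend φ j - extend φ' j)) := fun i j => by
    simp only [hp, hp', price]; ring
  have hsum : ∑ i, ∑ j, -((y i j - y' i j) * (p i j - p' i j)) = 0 := by
    have h1 : ∀ i j, -((y i j - y' i j) * (p i j - p' i j)) =
        -(w - w') * (K.d i j * y i j) - -(w - w') * (K.d i j * y' i j) -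
        ((extend φ i - extend φ' i) - (extend φ j - extend φ' j)) * (y i j - y' i j) :=
      fun i j => by rw [hdiff]; ring
    have h2 := sum_potential_mul_of_balanced (sub_balanced h.balance h'.balance)
      fun i => extend φ i - extend φ' i
    simp only [h1, Finset.sum_sub_distrib, ← Finset.mul_sum]
    rw [h2, h.supply, h'.supply, sub_self, sub_zero]
  have hterm : ∀ i j, p i j ≠ p' i j → 0 < -((y i j - y' i j) * (p i j - p' i j)) := by
    intro i j hne
    rcases lt_or_gt_of_ne hne with hlt | hlt
    · have : y' i j < y i j := totalDemand_strictAntiOn Q P i j (h.price_pos i j).le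
        (h'.price_pos i j).le hlt
      exact neg_pos.2 (mul_neg_of_pos_of_neg (sub_pos.2 this) (sub_neg.2 hlt))
    · have : y i j < y' i j := totalDemand_strictAntiOn Q P i j (h'.price_pos i j).le
        (h.price_pos i j).le hlt
      exact neg_pos.2 (mul_neg_of_neg_of_pos (sub_neg.2 this) (sub_pos.2 hlt))
  have hnn : ∀ i j, 0 ≤ -((y i j - y' i j) * (p i j - p' i j)) := fun i j => by
    by_cases heq : p i j = p' i j
    · simp [heq]
    · exact (hterm i j heq).le
  have hpp : ∀ i j, p i j = p' i j := fun i j => by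
    have h5 := (Finset.sum_eq_zero_iff_of_nonneg fun i _ => Finset.sum_nonneg fun j _ =>
      hnn i j).1 hsum i (Finset.mem_univ i)
    have h6 := (Finset.sum_eq_zero_iff_of_nonneg fun j _ => hnn i j).1 h5 j (Finset.mem_univ j)
    by_contra hne
    exact (hterm i j hne).ne' h6
  have hw : w - w' = 0 := by
    have h1 := hdiff 0 0
    rw [hpp, sub_self, sub_self, add_zero, zero_eq_mul] at h1
    exact h1.resolve_left (K.d_pos 0 0).ne'
  funext i
  have h1 := hdiff i.castSucc (Fin.last N)
  simp only [hpp, hw, extend_castSucc, extend_last, sub_self, mul_zero, zero_add, sub_zero] at h1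
  linarith

/-- Some multiplier is bounded, uniformly in the adjustments. Otherwise all trips towards locations
with smaller adjustments have large prices and little flow; so do all other trips, as each of them
enters a set `{k | φ i < φ k}` of locations which is left by trips of the former kind only. -/
lemma exists_multipliers_le : ∃ W : ℝ, ∀ φ : Fin N → ℝ, ∃ i, multipliers K Q P φ i ≤ W := by
  classical
  have hlim : Tendsto (fun W => (∑ i, ∑ j, K.d i j) *
      ∑ k, ∑ l, totalDemand Q P k l (K.d k l * W)) atTop (𝓝 0) := by
    have h1 : ∀ k l, Tendsto (fun W => totalDemand Q P k l (K.d k l * W)) atTop (𝓝 0) :=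
      fun k l => (totalDemand_tendsto_zero Q P k l).comp
        (tendsto_id.const_mul_atTop (K.d_pos k l))
    have h2 := (tendsto_finsetSum Finset.univ fun k _ =>
      tendsto_finsetSum Finset.univ fun l _ => h1 k l).const_mul (∑ i, ∑ j, K.d i j)
    simpa using h2
  obtain ⟨W, hWm, hW0⟩ := ((hlim.eventually (gt_mem_nhds K.m_pos)).and
    (eventually_ge_atTop 0)).exists
  refine ⟨W, fun φ => ?_⟩
  by_contra! hbig
  have h := multipliers_isMarketClearing Q P φ
  set y := driverFlow Q P (extend φ) (multipliers K Q P φ) with hy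
  set g := fun k l => totalDemand Q P k l (K.d k l * W) with hg
  have hg0 : ∀ k l, 0 ≤ g k l := fun k l =>
    (totalDemand_pos Q P k l (mul_nonneg (K.d_pos k l).le hW0)).le
  have hdown : ∀ k l, extend φ l ≤ extend φ k → y k l ≤ g k l := by
    intro k l hkl
    refine (totalDemand_strictAntiOn Q P k l).antitoneOn
      (mem_Ici.2 (mul_nonneg (K.d_pos k l).le hW0)) (mem_Ici.2 (h.price_pos k l).le) ?_
    have h1 := mul_le_mul_of_nonneg_left (hbig k).le (K.d_pos k l).le
    have h2 := K.c_nonneg k l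
    simp only [price]
    linarith
  have hall : ∀ i j, y i j ≤ ∑ k, ∑ l, g k l := by
    intro i j
    rcases le_or_gt (extend φ j) (extend φ i) with hij | hij
    · calc y i j ≤ g i j := hdown i j hij
        _ ≤ ∑ l, g i l := Finset.single_le_sum (fun l _ => hg0 i l) (Finset.mem_univ j)
        _ ≤ ∑ k, ∑ l, g k l := Finset.single_le_sum (f := fun k => ∑ l, g k l)
          (fun k _ => Finset.sum_nonneg fun l _ => hg0 k l) (Finset.mem_univ i)
    · set U : Finset (Fin (N + 1)) := Finset.univ.filter fun k => extend φ i < extend φ k with hU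
      have hjU : j ∈ U := by simp [hU, hij]
      have hiU : i ∈ Uᶜ := by simp [hU]
      have hy0 : ∀ k l, 0 ≤ y k l := fun k l => (h.flow_pos k l).le
      calc y i j ≤ ∑ l ∈ Uᶜ, y l j :=
            Finset.single_le_sum (f := fun l => y l j) (fun l _ => hy0 l j) hiU
        _ ≤ ∑ k ∈ U, ∑ l ∈ Uᶜ, y l k :=
            Finset.single_le_sum (f := fun k => ∑ l ∈ Uᶜ, y l k)
              (fun k _ => Finset.sum_nonneg fun l _ => hy0 l k) hjU
        _ = ∑ k ∈ U, ∑ l ∈ Uᶜ, y k l := (sum_cut_eq_of_balanced h.balance U).symm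
        _ ≤ ∑ k ∈ U, ∑ l ∈ Uᶜ, g k l := by
            refine Finset.sum_le_sum fun k hk => Finset.sum_le_sum fun l hl => hdown k l ?_
            simp only [hU, Finset.mem_compl, Finset.mem_filter, Finset.mem_univ, true_and,
              not_lt] at hk hl
            exact hl.trans hk.le
        _ ≤ ∑ k ∈ U, ∑ l, g k l := Finset.sum_le_sum fun k _ =>
            Finset.sum_le_univ_sum_of_nonneg fun l => hg0 k l
        _ ≤ ∑ k, ∑ l, g k l :=
            Finset.sum_le_univ_sum_of_nonneg fun k => Finset.sum_nonneg fun l _ => hg0 k l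
  have h1 : K.m ≤ (∑ i, ∑ j, K.d i j) * ∑ k, ∑ l, g k l := by
    rw [← h.supply, Finset.sum_mul]
    refine Finset.sum_le_sum fun i _ => ?_
    rw [Finset.sum_mul]
    exact Finset.sum_le_sum fun j _ => mul_le_mul_of_nonneg_left (hall i j) (K.d_pos i j).le
  exact hWm.not_ge h1

lemma isCompact_lyapunov_le (C : ℝ) : IsCompact {φ | lyapunov K Q P φ ≤ C} := by
  obtain ⟨W, hW⟩ := exists_multipliers_le (K := K) Q P
  obtain ⟨B, hB⟩ : ∃ B : ℝ, ∀ i j, K.c i j + K.d i j * (W + 2 * √C) ≤ B := by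
    obtain ⟨a, ha⟩ := Finite.exists_max fun a : Fin (N + 1) × Fin (N + 1) =>
      K.c a.1 a.2 + K.d a.1 a.2 * (W + 2 * √C)
    exact ⟨_, fun i j => ha (i, j)⟩
  refine (isCompact_univ_pi fun _ : Fin N => isCompact_Icc (a := -B) (b := B)).of_isClosed_subset
    (isClosed_le (lyapunov_contDiff Q P).continuous continuous_const) fun φ hφ => ?_
  have hdev : ∀ i, |multipliers K Q P φ i - 1 / ((N : ℝ) + 1) * ∑ j, multipliers K Q P φ j| ≤ √C :=
    fun i => Real.abs_le_sqrt ((Finset.single_le_sum (f := fun i => (multipliers K Q P φ i -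
      1 / ((N : ℝ) + 1) * ∑ j, multipliers K Q P φ j) ^ 2) (fun _ _ => sq_nonneg _)
      (Finset.mem_univ i)).trans hφ)
  obtain ⟨k, hk⟩ := hW φ
  have hle : ∀ i, multipliers K Q P φ i ≤ W + 2 * √C := fun i => by
    have h1 := (abs_le.1 (hdev i)).2
    have h2 := (abs_le.1 (hdev k)).1
    linarith
  have hB' : ∀ i j, extend φ j - extend φ i ≤ B := fun i j => by
    have h1 := price_multipliers_pos Q P φ i j
    have h2 := mul_le_mul_of_nonneg_left (hle i) (K.d_pos i j).le
    have h3 := hB i j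
    simp only [price] at h1
    linarith
  intro i _
  have h1 := hB' (Fin.last N) i.castSucc
  have h2 := hB' i.castSucc (Fin.last N)
  simp only [extend_castSucc, extend_last] at h1 h2
  exact ⟨by linarith, by linarith⟩

variable {τ : ℝ}

/-- The stepsize in a form that is visibly continuous, also where the norm vanishes. -/
lemma stepsize_eq (hτ : 0 < τ) (φ δ : Fin N → ℝ) : stepsize K Q P τ φ δ =
    (max 1 (‖fderiv ℝ (multipliers K Q P) φ δ‖ / τ))⁻¹ := by
  rw [stepsize]
  split_ifs with h
  · simp [h]
  · have h1 : 0 < ‖fderiv ℝ (multipliers K Q P) φ δ‖ := (norm_nonneg _).lt_of_ne' h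
    have h2 : 0 < ‖fderiv ℝ (multipliers K Q P) φ δ‖ / τ := div_pos h1 hτ
    rcases le_total 1 (‖fderiv ℝ (multipliers K Q P) φ δ‖ / τ) with h3 | h3
    · rw [max_eq_right h3, inv_div, min_eq_right]
      rw [div_le_one h1]
      exact (one_le_div hτ).1 h3
    · rw [max_eq_left h3, inv_one, min_eq_left]
      rw [one_le_div h1]
      exact (div_le_one hτ).1 h3

lemma stepsize_pos (hτ : 0 < τ) (φ δ : Fin N → ℝ) : 0 < stepsize K Q P τ φ δ := by
  rw [stepsize_eq Q P hτ]
  positivity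

lemma stepsize_le_one (hτ : 0 < τ) (φ δ : Fin N → ℝ) : stepsize K Q P τ φ δ ≤ 1 := by
  rw [stepsize_eq Q P hτ]
  exact inv_le_one_of_one_le₀ (le_max_left _ _)

lemma stepsize_direction_continuous (hτ : 0 < τ) :
    Continuous fun φ => stepsize K Q P τ φ (direction K Q P φ) := by
  simp only [stepsize_eq Q P hτ]
  refine Continuous.inv₀ (continuous_const.max ((((fderiv_multipliers_continuous Q P).clm_apply
    (direction_continuous Q P)).norm).div_const τ)) fun φ => ?_
  positivity

/-- The adjustments of the INP mechanism converge to a zero of the Lyapunov function. -/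
lemma exists_tendsto_inpAdj {β σ : ℝ} (hτ : 0 < τ) (hβ : β ∈ Ioo (0 : ℝ) 1)
    (hσ : σ ∈ Ioo (0 : ℝ) 1) :
    ∃ φ, lyapunov K Q P φ = 0 ∧ Tendsto (inpAdj K Q P τ β σ) atTop (𝓝 φ) := by
  classical
  set S := inpState K Q P τ β σ with hS
  have hfirst : S 1 = newDirection K Q P τ (S 0).adj := by simp [hS, inpState]
  have hsucc : ∀ t, (SufficientProgress K Q P σ (S (t + 1)) →
        S (t + 2) = newDirection K Q P τ (S (t + 1)).adj) ∧
      (¬ SufficientProgress K Q P σ (S (t + 1)) → S (t + 2) = backtrack β (S (t + 1))) := by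
    intro t
    have h1 : S (t + 2) = if t + 1 = 0 ∨ SufficientProgress K Q P σ (S (t + 1)) then
        newDirection K Q P τ (S (t + 1)).adj else backtrack β (S (t + 1)) := by
      rw [hS]
      conv_lhs => rw [inpState]
    constructor
    · intro h
      rw [h1, if_pos (Or.inr h)]
    · intro h
      rw [h1, if_neg (by simp [h])]
  have hinv : ∀ t, (S (t + 1)).dir = direction K Q P (S (t + 1)).base ∧
      (S (t + 1)).adj = (S (t + 1)).base + (S (t + 1)).step • (S (t + 1)).dir := by
    intro t
    induction t with
    | zero => rw [zero_add, hfirst]; exact ⟨rfl, rfl⟩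
    | succ t ih =>
      by_cases h : SufficientProgress K Q P σ (S (t + 1))
      · rw [(hsucc t).1 h]; exact ⟨rfl, rfl⟩
      · rw [(hsucc t).2 h]; exact ⟨ih.1, rfl⟩
  have hprog : ∀ t, SufficientProgress K Q P σ (S (t + 1)) ↔
      lyapunov K Q P ((S (t + 1)).base + (S (t + 1)).step • direction K Q P (S (t + 1)).base) <
        lyapunov K Q P (S (t + 1)).base + σ * fderiv ℝ (lyapunov K Q P) (S (t + 1)).base
          ((S (t + 1)).step • direction K Q P (S (t + 1)).base) := fun t => by
    rw [SufficientProgress, (hinv t).2, (hinv t).1]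
  obtain ⟨φ, hφ, hlim⟩ := tendsto_of_backtracking (base := fun t => (S (t + 1)).base)
    (step := fun t => (S (t + 1)).step) (lyapunov_contDiff Q P) (lyapunov_nonneg Q P)
    (isCompact_lyapunov_le Q P) (direction_continuous Q P) (fderiv_lyapunov_direction Q P)
    (fun x hx => direction_eq_zero Q P (multipliers_eq_of_lyapunov_eq_zero Q P hx))
    (fun x y hx hy => by
      have h1 := multipliers_isMarketClearing Q P x
      have h2 := multipliers_isMarketClearing Q P y
      rw [funext (multipliers_eq_of_lyapunov_eq_zero Q P hx)] at h1
      rw [funext (multipliers_eq_of_lyapunov_eq_zero Q P hy)] at h2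
      exact eq_of_isMarketClearing_const h1 h2)
    (stepsize_direction_continuous Q P hτ) (fun x => stepsize_pos Q P hτ x _)
    (fun x => stepsize_le_one Q P hτ x _) hβ hσ (by simp only [zero_add, hfirst]; rfl)
    (fun t h => by
      have h1 := (hsucc t).1 ((hprog t).2 h)
      simp only [h1, newDirection, and_true]
      rw [(hinv t).2, (hinv t).1])
    (fun t h => by
      have h1 := (hsucc t).2 fun h2 => h ((hprog t).1 h2)
      simp only [h1, backtrack, and_self])
  refine ⟨φ, hφ, (tendsto_add_atTop_iff_nat 1).1 (hlim.congr fun t => ?_)⟩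
  rw [← (hinv t).1, ← (hinv t).2]
  rfl

end

/-! ### Welfare -/

section

variable (Q : RiderDemand N) (i j : Fin (N + 1))

lemma RiderDemand.exists_eq {s : ℝ} (hs : s ∈ Ioc 0 (Q.q i j 0)) :
    ∃ r ∈ Ici (0 : ℝ), Q.q i j r = s := by
  obtain ⟨R, hRs, hR⟩ := (((Q.tendsto_zero i j).eventually (gt_mem_nhds hs.1)).and
    (eventually_ge_atTop 0)).exists
  obtain ⟨r, hr, h⟩ := intermediate_value_Icc' hR
    ((Q.contDiffOn i j).continuousOn.mono Icc_subset_Ici_self) ⟨hRs.le, hs.2⟩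
  exact ⟨r, hr.1, h⟩

lemma RiderDemand.v_nonneg {s : ℝ} (hs : s ∈ Ioc 0 (Q.q i j 0)) : 0 ≤ Q.v i j s :=
  Function.invFunOn_mem (Q.exists_eq i j hs)

lemma RiderDemand.q_v {s : ℝ} (hs : s ∈ Ioc 0 (Q.q i j 0)) : Q.q i j (Q.v i j s) = s :=
  Function.invFunOn_eq (Q.exists_eq i j hs)

lemma RiderDemand.le_v_iff {s r : ℝ} (hs : s ∈ Ioc 0 (Q.q i j 0)) (hr : 0 ≤ r) :
    r ≤ Q.v i j s ↔ s ≤ Q.q i j r := by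
  rw [← (Q.strictAntiOn i j).le_iff_ge (Q.v_nonneg i j hs) hr, Q.q_v i j hs]

lemma RiderDemand.v_le_iff {s r : ℝ} (hs : s ∈ Ioc 0 (Q.q i j 0)) (hr : 0 ≤ r) :
    Q.v i j s ≤ r ↔ Q.q i j r ≤ s := by
  rw [← (Q.strictAntiOn i j).le_iff_ge hr (Q.v_nonneg i j hs), Q.q_v i j hs]

lemma RiderDemand.v_antitoneOn : AntitoneOn (Q.v i j) (Ioc 0 (Q.q i j 0)) :=
  fun s hs t ht hst => (Q.le_v_iff i j hs (Q.v_nonneg i j ht)).2 (by rwa [Q.q_v i j ht])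

/-- The total value of all riders is finite: `v` and `q` have the same region under their graphs,
up to exchanging the coordinates. -/
lemma RiderDemand.v_integrableOn :
    MeasureTheory.IntegrableOn (Q.v i j) (Ioc 0 (Q.q i j 0)) := by
  have hmeas : AEMeasurable (Q.v i j) (MeasureTheory.volume.restrict (Ioc 0 (Q.q i j 0))) :=
    aemeasurable_restrict_of_antitoneOn measurableSet_Ioc (Q.v_antitoneOn i j)
  have hnn : 0 ≤ᵐ[MeasureTheory.volume.restrict (Ioc 0 (Q.q i j 0))] Q.v i j :=
    (MeasureTheory.ae_restrict_iff' measurableSet_Ioc).2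
      (Eventually.of_forall fun s hs => Q.v_nonneg i j hs)
  refine (MeasureTheory.lintegral_ofReal_ne_top_iff_integrable hmeas.aestronglyMeasurable hnn).1 ?_
  rw [MeasureTheory.lintegral_eq_lintegral_meas_lt _ hnn hmeas]
  refine ne_top_of_le_ne_top (MeasureTheory.Integrable.lintegral_lt_top (Q.integrable i j)).ne ?_
  refine MeasureTheory.setLIntegral_mono' measurableSet_Ioi fun t ht => ?_
  rw [MeasureTheory.Measure.restrict_apply' measurableSet_Ioc]
  calc MeasureTheory.volume ({a | t < Q.v i j a} ∩ Ioc 0 (Q.q i j 0))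
      ≤ MeasureTheory.volume (Ioc 0 (Q.q i j t)) := MeasureTheory.measure_mono fun s hs =>
        ⟨hs.2.1, (Q.le_v_iff i j hs.2 (le_of_lt ht)).1 (le_of_lt hs.1)⟩
    _ = ENNReal.ofReal (Q.q i j t) := by rw [Real.volume_Ioc, sub_zero]

/-- At the price `p`, the rider flow `q p` maximizes rider surplus. -/
lemma RiderDemand.integral_v_sub_le {p x : ℝ} (hp : 0 ≤ p) (hx : x ∈ Icc 0 (Q.q i j 0)) :
    (∫ s in (0 : ℝ)..x, Q.v i j s) - p * x ≤
      (∫ s in (0 : ℝ)..Q.q i j p, Q.v i j s) - p * Q.q i j p := by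
  have hq : Q.q i j p ∈ Icc 0 (Q.q i j 0) :=
    ⟨Q.nonneg i j p hp, (Q.strictAntiOn i j).antitoneOn (mem_Ici.2 le_rfl) hp hp⟩
  have hint : ∀ a ∈ Icc 0 (Q.q i j 0), ∀ b ∈ Icc 0 (Q.q i j 0),
      IntervalIntegrable (Q.v i j) MeasureTheory.volume a b := fun a ha b hb =>
    intervalIntegrable_iff.2 ((Q.v_integrableOn i j).mono_set
      (Ioc_subset_Ioc (le_min ha.1 hb.1) (max_le ha.2 hb.2)))
  have h0 : (0 : ℝ) ∈ Icc 0 (Q.q i j 0) := ⟨le_rfl, Q.nonneg i j 0 le_rfl⟩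
  have hsub := intervalIntegral.integral_interval_sub_left (hint 0 h0 x hx) (hint 0 h0 _ hq)
  rcases le_total (Q.q i j p) x with h | h
  · have h1 := intervalIntegral.integral_mono_on_of_le_Ioo h (hint _ hq _ hx)
      (intervalIntegrable_const (c := p)) fun s hs =>
        (Q.v_le_iff i j ⟨hq.1.trans_lt hs.1, hs.2.le.trans hx.2⟩ hp).2 hs.1.le
    rw [intervalIntegral.integral_const, smul_eq_mul] at h1
    linarith
  · have h1 := intervalIntegral.integral_mono_on_of_le_Ioo h
      (intervalIntegrable_const (c := p)) (hint _ hx _ hq) fun s hs =>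
        (Q.le_v_iff i j ⟨hx.1.trans_lt hs.1, hs.2.le.trans hq.2⟩ hp).2 hs.2.le
    rw [intervalIntegral.integral_const, smul_eq_mul] at h1
    rw [intervalIntegral.integral_symm x (Q.q i j p)] at hsub
    linarith

end

/-- At prices with equal multipliers, the net revenue of a balanced driver flow is the multiplier
times the number of drivers used. -/
lemma sum_price_sub_cost_mul {φ : Fin (N + 1) → ℝ} {w : ℝ} {y : Fin (N + 1) → Fin (N + 1) → ℝ}
    (hy : ∀ i, ∑ j, y i j = ∑ j, y j i) :
    ∑ i, ∑ j, (price K φ (fun _ => w) i j - K.c i j) * y i j = w * ∑ i, ∑ j, K.d i j * y i j := by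
  have h1 : ∀ i j, (price K φ (fun _ => w) i j - K.c i j) * y i j =
      w * (K.d i j * y i j) + (φ i - φ j) * y i j := fun i j => by simp only [price]; ring
  simp only [h1, Finset.sum_add_distrib, sum_potential_mul_of_balanced hy, ← Finset.mul_sum,
    add_zero]

section

variable {Q : RiderDemand N} {P : PhantomDemand K}

/-- Weak duality, with the prices as multipliers of the rider pickup constraints. -/
lemma IsClearingOutcome.welfare_gap_le {φ : Fin (N + 1) → ℝ} {w : ℝ} {o : Outcome N}
    (h : IsClearingOutcome K Q P φ (fun _ => w) o) {x y : Fin (N + 1) → Fin (N + 1) → ℝ}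
    (hxy : IsFeasibleFlow K x y) (hx : ∀ i j, x i j ∈ Icc 0 (Q.q i j 0)) :
    ∑ i, ∑ j, ((∫ s in (0 : ℝ)..x i j, Q.v i j s) - K.c i j * y i j) ≤
      K.m * max 0 (-w) + ∑ i, ∑ j, o.p i j * P.q i j (o.p i j) +
        ∑ i, ∑ j, ((∫ s in (0 : ℝ)..o.x i j, Q.v i j s) - K.c i j * o.y i j) := by
  have hterm : ∀ i j, (∫ s in (0 : ℝ)..x i j, Q.v i j s) - K.c i j * y i j ≤
      ((∫ s in (0 : ℝ)..o.x i j, Q.v i j s) - K.c i j * o.y i j) +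
        o.p i j * P.q i j (o.p i j) + (o.p i j - K.c i j) * y i j -
        (o.p i j - K.c i j) * o.y i j := by
    intro i j
    have h1 := Q.integral_v_sub_le i j (h.feasible.p_nonneg i j) (hx i j)
    rw [← h.rider i j] at h1
    have h2 := mul_le_mul_of_nonneg_left (hxy.x_le_y i j) (h.feasible.p_nonneg i j)
    have h3 : o.p i j * P.q i j (o.p i j) = o.p i j * o.y i j - o.p i j * o.x i j := by
      rw [← h.relocation i j]; ring
    linarith
  have hsum := Finset.sum_le_sum fun i (_ : i ∈ Finset.univ) =>
    Finset.sum_le_sum fun j (_ : j ∈ Finset.univ) => hterm i j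
  simp only [h.price_eq] at hsum ⊢
  simp only [Finset.sum_add_distrib, Finset.sum_sub_distrib] at hsum ⊢
  have e1 := sum_price_sub_cost_mul (K := K) (φ := φ) (w := w) hxy.balance
  have e2 := sum_price_sub_cost_mul (K := K) (φ := φ) (w := w) h.feasible.flow.balance
  rw [h.supply] at e2
  have h4 : w * ∑ i, ∑ j, K.d i j * y i j ≤ K.m * max 0 (-w) + w * K.m := by
    have hD : 0 ≤ ∑ i, ∑ j, K.d i j * y i j := Finset.sum_nonneg fun i _ =>
      Finset.sum_nonneg fun j _ => mul_nonneg (K.d_pos i j).le (hxy.y_nonneg i j)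
    rcases le_total 0 w with hw | hw
    · rw [max_eq_left (neg_nonpos.2 hw)]
      have := mul_le_mul_of_nonneg_left hxy.supply hw
      linarith
    · rw [max_eq_right (neg_nonneg.2 hw)]
      have := mul_nonneg (neg_nonneg.2 hw) hD
      linarith
  rw [e1, e2] at hsum
  linarith

lemma coe_sum_price_mul_le_sum_slack (P : PhantomDemand K) {p : Fin (N + 1) → Fin (N + 1) → ℝ}
    (hp : ∀ i j, 0 ≤ p i j) :
    ((∑ i, ∑ j, p i j * P.q i j (p i j) : ℝ) : EReal) ≤ ∑ i, ∑ j, P.slack i j := by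
  have hcoe : ∀ f : Fin (N + 1) → ℝ, ((∑ i, f i : ℝ) : EReal) = ∑ i, (f i : EReal) := fun f =>
    map_sum (⟨⟨Real.toEReal, EReal.coe_zero⟩, EReal.coe_add⟩ : ℝ →+ EReal) f Finset.univ
  simp only [hcoe]
  exact Finset.sum_le_sum fun i _ => Finset.sum_le_sum fun j _ =>
    le_iSup (fun r : Ici (0 : ℝ) => (((r : ℝ) * P.q i j r : ℝ) : EReal)) ⟨p i j, hp i j⟩

lemma IsClearingOutcome.suboptimality_le {φ : Fin (N + 1) → ℝ} {w : ℝ} {o : Outcome N}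
    (h : IsClearingOutcome K Q P φ (fun _ => w) o) :
    suboptimality K Q o ≤ ((K.m * max 0 (-w) : ℝ) : EReal) + ∑ i, ∑ j, P.slack i j := by
  have hox : ∀ i j, o.x i j ∈ Icc 0 (Q.q i j 0) := fun i j => by
    have hp := h.feasible.p_nonneg i j
    rw [h.rider i j]
    exact ⟨Q.nonneg i j _ hp, (Q.strictAntiOn i j).antitoneOn (mem_Ici.2 le_rfl) hp hp⟩
  have hw : welfare K Q o.x o.y =
      ((∑ i, ∑ j, ((∫ s in (0 : ℝ)..o.x i j, Q.v i j s) - K.c i j * o.y i j) : ℝ) : EReal) :=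
    if_pos hox
  rw [suboptimality, hw, EReal.sub_le_iff_le_add (Or.inl (EReal.coe_ne_bot _))
    (Or.inl (EReal.coe_ne_top _))]
  refine iSup_le fun x => iSup_le fun y => iSup_le fun hxy => ?_
  rw [welfare]
  split_ifs with hx
  · refine (EReal.coe_le_coe_iff.2 (h.welfare_gap_le hxy hx)).trans ?_
    rw [EReal.coe_add, EReal.coe_add]
    exact add_le_add_left (add_le_add_right
      (coe_sum_price_mul_le_sum_slack P h.feasible.p_nonneg) _) _
  · exact bot_le

end

/-! ### The mechanism only uses the observed outcomes -/

section

variable {P : PhantomDemand K} {Q Q' : RiderDemand N} {τ β σ : ℝ}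

/-- The derivative of the multipliers is determined by the observation, being the solution of a
linear system whose coefficients involve the rider demand through its slopes only. -/
lemma fderiv_multipliers_eq_of_observe_eq {φ : Fin N → ℝ}
    (h : observe K Q P φ = observe K Q' P φ) :
    fderiv ℝ (multipliers K Q P) φ = fderiv ℝ (multipliers K Q' P) φ := by
  have hπ : multipliers K Q P φ = multipliers K Q' P φ := congrArg Observation.π h
  have hsens := congrArg Observation.sens h
  have hA : clearingCLM Q P (φ, multipliers K Q P φ) =
      clearingCLM Q' P (φ, multipliers K Q' P φ) := by
    have hflow : ∀ i j, flowCLM Q P (φ, multipliers K Q P φ) i j =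
        flowCLM Q' P (φ, multipliers K Q' P φ) i j := fun i j => by
      have h1 : derivWithin (Q.q i j) (Ici 0) (price K (extend φ) (multipliers K Q P φ) i j) =
          derivWithin (Q'.q i j) (Ici 0) (price K (extend φ) (multipliers K Q' P φ) i j) :=
        congrFun (congrFun hsens i) j
      simp only [flowCLM, demandSlope, h1]
      rw [hπ]
    simp only [clearingCLM, hflow]
  refine ContinuousLinearMap.ext fun v => sub_eq_zero.1 ?_
  refine eq_zero_of_clearingCLM_eq_zero (Q := Q) (P := P) (z := (φ, multipliers K Q P φ))
    (price_multipliers_pos Q P φ) ?_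
  have h1 := clearingCLM_fderiv_multipliers Q P φ v
  have h2 := clearingCLM_fderiv_multipliers Q' P φ v
  rw [← hA] at h2
  have h3 : ((0 : Fin N → ℝ), fderiv ℝ (multipliers K Q P) φ v - fderiv ℝ (multipliers K Q' P) φ v)
      = (v, fderiv ℝ (multipliers K Q P) φ v) - (v, fderiv ℝ (multipliers K Q' P) φ v) := by
    rw [Prod.mk_sub_mk, sub_self]
  rw [h3, map_sub, h1, h2, sub_self]

lemma lyapunov_eq_of_observe_eq {φ : Fin N → ℝ} (h : observe K Q P φ = observe K Q' P φ) :
    lyapunov K Q P φ = lyapunov K Q' P φ := by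
  have hπ : multipliers K Q P φ = multipliers K Q' P φ := congrArg Observation.π h
  simp only [lyapunov, hπ]

lemma fderiv_lyapunov_eq_of_observe_eq {φ : Fin N → ℝ}
    (h : observe K Q P φ = observe K Q' P φ) :
    fderiv ℝ (lyapunov K Q P) φ = fderiv ℝ (lyapunov K Q' P) φ := by
  have hπ : multipliers K Q P φ = multipliers K Q' P φ := congrArg Observation.π h
  refine ContinuousLinearMap.ext fun v => ?_
  simp only [fderiv_lyapunov, hπ, fderiv_multipliers_eq_of_observe_eq h]

lemma newDirection_eq_of_observe_eq {φ : Fin N → ℝ} (h : observe K Q P φ = observe K Q' P φ) :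
    newDirection K Q P τ φ = newDirection K Q' P τ φ := by
  have hπ : multipliers K Q P φ = multipliers K Q' P φ := congrArg Observation.π h
  have hD := fderiv_multipliers_eq_of_observe_eq h
  have hM : newtonMatrix K Q P φ = newtonMatrix K Q' P φ := by
    unfold newtonMatrix
    rw [hD]
  have hδ : direction K Q P φ = direction K Q' P φ := by
    unfold direction
    rw [hM, hπ]
  simp only [newDirection, stepsize, hδ, hD]

variable (K Q P τ β σ) in
/-- The base point of the search is an adjustment whose outcome has been observed. -/
lemma exists_inpState_base_eq (t : ℕ) :
    ∃ s ≤ t, (inpState K Q P τ β σ (t + 1)).base = inpAdj K Q P τ β σ s := by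
  induction t with
  | zero => exact ⟨0, le_rfl, by simp [inpState, newDirection, inpAdj]⟩
  | succ t ih =>
    obtain ⟨s, hs, heq⟩ := ih
    rw [inpState]
    split_ifs
    · exact ⟨t + 1, le_rfl, rfl⟩
    · exact ⟨s, hs.trans (Nat.le_succ t), heq⟩

/-- Rider demands with the same observations before time `t` lead to the same state at time `t`. -/
lemma inpState_eq_of_observe_eq {t : ℕ}
    (h : ∀ s < t, observe K Q P (inpAdj K Q P τ β σ s) = observe K Q' P (inpAdj K Q' P τ β σ s)) :
    inpState K Q P τ β σ t = inpState K Q' P τ β σ t := by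
  induction t with
  | zero => rfl
  | succ t ih =>
    have hst := ih fun s hs => h s (hs.trans (Nat.lt_succ_self t))
    have hobs : ∀ s ≤ t, observe K Q P (inpAdj K Q P τ β σ s) =
        observe K Q' P (inpAdj K Q P τ β σ s) := fun s hs => by
      have h1 := h s (Nat.lt_succ_of_le hs)
      have h2 : inpAdj K Q P τ β σ s = inpAdj K Q' P τ β σ s := congrArg Observation.φ h1
      rw [h1, h2]
    have hnew := newDirection_eq_of_observe_eq (τ := τ) (hobs t le_rfl)
    simp only [inpAdj] at hnew
    cases t with
    | zero => simpa [inpState] using hnew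
    | succ t =>
      obtain ⟨s, hs, hbase⟩ := exists_inpState_base_eq K P Q τ β σ t
      have hobs_base := hobs s (hs.trans (Nat.le_succ t))
      rw [← hbase] at hobs_base
      have hprog : SufficientProgress K Q P σ (inpState K Q P τ β σ (t + 1)) ↔
          SufficientProgress K Q' P σ (inpState K Q' P τ β σ (t + 1)) := by
        rw [← hst, SufficientProgress, SufficientProgress, lyapunov_eq_of_observe_eq hobs_base,
          fderiv_lyapunov_eq_of_observe_eq hobs_base]
        have := lyapunov_eq_of_observe_eq (hobs (t + 1) le_rfl)
        simp only [inpAdj] at this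
        rw [this]
      conv_lhs => rw [inpState]
      conv_rhs => rw [inpState]
      rw [← hst, ← hnew]
      rw [← hst] at hprog
      split_ifs with h1 h2 h2
      exacts [rfl, absurd (h1.imp_right hprog.1) h2, absurd (h2.imp_right hprog.2) h1, rfl]

end

open Classical in
/-- The pricing rule of the INP mechanism. It evaluates the mechanism on any rider demand
consistent with the history; by `inpState_eq_of_observe_eq` the choice does not matter. -/
noncomputable def inpRule (K : MarketCondition N) (P : PhantomDemand K) (τ β σ : ℝ) :
    IterativePricingMechanism N where
  rule t h :=
    if hQ : ∃ Q : RiderDemand N, inpHistory K Q P τ β σ t = h then inpAdj K hQ.choose P τ β σ t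
    else 0
  rule_zero h := by
    split_ifs <;> rfl

lemma inpAdj_eq_inpRule (K : MarketCondition N) (P : PhantomDemand K) (τ β σ : ℝ)
    (Q : RiderDemand N) (t : ℕ) :
    inpAdj K Q P τ β σ t = (inpRule K P τ β σ).rule t (inpHistory K Q P τ β σ t) := by
  have hQ : ∃ Q' : RiderDemand N, inpHistory K Q' P τ β σ t = inpHistory K Q P τ β σ t := ⟨Q, rfl⟩
  have h1 : (inpRule K P τ β σ).rule t (inpHistory K Q P τ β σ t) =
      inpAdj K hQ.choose P τ β σ t := dif_pos hQ
  rw [h1, inpAdj, inpAdj, inpState_eq_of_observe_eq fun s hs => ?_]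
  exact (congrFun hQ.choose_spec ⟨s, hs⟩).symm

/-! ### The limit outcome -/

lemma outcome_continuous (Q : RiderDemand N) (P : PhantomDemand K) :
    Continuous (fun φ => (outcome K Q P φ).x) ∧ Continuous (fun φ => (outcome K Q P φ).y) ∧
      Continuous fun φ => (outcome K Q P φ).p := by
  have hp : ∀ i j, Continuous fun φ => price K (extend φ) (multipliers K Q P φ) i j := fun i j =>
    (price_contDiff i j).continuous.comp
      (continuous_id.prodMk (multipliers_contDiff Q P).continuous)
  have hpos : ∀ i j φ, price K (extend φ) (multipliers K Q P φ) i j ∈ Ici 0 := fun i j φ =>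
    (price_multipliers_pos Q P φ i j).le
  have hx : ∀ i j, Continuous fun φ =>
      Q.q i j (price K (extend φ) (multipliers K Q P φ) i j) := fun i j =>
    (Q.contDiffOn i j).continuousOn.comp_continuous (hp i j) (hpos i j)
  have hy : ∀ i j, Continuous fun φ =>
      P.q i j (price K (extend φ) (multipliers K Q P φ) i j) := fun i j =>
    (P.contDiffOn i j).continuousOn.comp_continuous (hp i j) (hpos i j)
  exact ⟨continuous_pi fun i => continuous_pi fun j => hx i j,
    continuous_pi fun i => continuous_pi fun j => (hx i j).add (hy i j),
    continuous_pi fun i => continuous_pi fun j => hp i j⟩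

end RideINP

open RideINP in
theorem mainTheorem1 {N : ℕ} (hN : 1 < N + 1) (K : MarketCondition N) (P : PhantomDemand K)
    (τ β σ : ℝ) (hτ : 0 < τ) (hβ : β ∈ Ioo (0 : ℝ) 1) (hσ : σ ∈ Ioo (0 : ℝ) 1) :
    -- the INP mechanism only uses the market condition, the phantom demand and the history
    (∃ M : IterativePricingMechanism N, ∀ (Q : RiderDemand N) (t : ℕ),
      inpAdj K Q P τ β σ t = M.rule t (inpHistory K Q P τ β σ t)) ∧
    ∀ Q : RiderDemand N,
      -- the mechanism is well defined
      (∀ φ : Fin N → ℝ, ∃! π : Fin (N + 1) → ℝ, IsMarketClearing K Q P (extend φ) π) ∧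
      (∀ φ : Fin N → ℝ,
        IsClearingOutcome K Q P (extend φ) (multipliers K Q P φ) (outcome K Q P φ)) ∧
      ContDiff ℝ 1 (multipliers K Q P) ∧
      (∀ φ : Fin N → ℝ, IsUnit (newtonMatrix K Q P φ).det) ∧
      -- it converges to a market-clearing outcome with equal multipliers
      ∃ (ω : ℝ) (φ : Fin N → ℝ) (o : Outcome N),
        (∀ i, Tendsto (fun t => multipliers K Q P (inpAdj K Q P τ β σ t) i) atTop (𝓝 ω)) ∧
        Tendsto (fun t => inpAdj K Q P τ β σ t) atTop (𝓝 φ) ∧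
        Tendsto (fun t => (outcome K Q P (inpAdj K Q P τ β σ t)).x) atTop (𝓝 o.x) ∧
        Tendsto (fun t => (outcome K Q P (inpAdj K Q P τ β σ t)).y) atTop (𝓝 o.y) ∧
        Tendsto (fun t => (outcome K Q P (inpAdj K Q P τ β σ t)).p) atTop (𝓝 o.p) ∧
        IsClearingOutcome K Q P (extend φ) (fun _ => ω) o ∧
        -- whose welfare suboptimality is bounded
        suboptimality K Q o ≤ ((K.m * max 0 (-ω) : ℝ) : EReal) + ∑ i, ∑ j, P.slack i j := by
  refine ⟨⟨inpRule K P τ β σ, fun Q t => inpAdj_eq_inpRule K P τ β σ Q t⟩, fun Q => ?_⟩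
  refine ⟨fun φ => ⟨multipliers K Q P φ, multipliers_isMarketClearing Q P φ,
    fun π hπ => (hπ.multipliers_eq).symm⟩, outcome_isClearingOutcome Q P,
    multipliers_contDiff Q P, newtonMatrix_isUnit_det Q P, ?_⟩
  obtain ⟨φ, hφ, hlim⟩ := exists_tendsto_inpAdj (K := K) Q P hτ hβ hσ
  obtain ⟨hx, hy, hp⟩ := outcome_continuous Q P
  set w : ℝ := 1 / ((N : ℝ) + 1) * ∑ j, multipliers K Q P φ j with hw
  have hπ : ∀ i, multipliers K Q P φ i = w := multipliers_eq_of_lyapunov_eq_zero Q P hφ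
  have hclear : IsClearingOutcome K Q P (extend φ) (fun _ => w) (outcome K Q P φ) := by
    rw [← funext hπ]
    exact outcome_isClearingOutcome Q P φ
  refine ⟨w, φ, outcome K Q P φ, fun i => ?_, hlim, (hx.tendsto φ).comp hlim,
    (hy.tendsto φ).comp hlim, (hp.tendsto φ).comp hlim, hclear, hclear.suboptimality_le⟩
  rw [← hπ i]
  exact (((continuous_apply i).comp (multipliers_contDiff Q P).continuous).tendsto φ).comp hlim
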